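/- All graphs are finite and simple. A \emph{split} of a vertex $v$ of a graph $G$ chooses $A,B\subseteq N_G(v)$ with $A\cup B=N_G(v)$ and replaces $v$ by two new non-adjacent vertices $v_1,v_2$, where $v_1$ is adjacent exactly to the vertices of $A$ and $v_2$ exactly to the vertices of $B$; it is \emph{exclusive} if $A\cap B=\emptyset$. A \emph{unit interval graph} is an intersection graph of intervals of length $1$ on the real line. Let $UIVS(G)$ (respectively $UIVXS(G)$) be the minimum length of a sequence of splits (respectively of exclusive splits) that turns $G$ into a unit interval graph. Corollary. For every triangle-free graph $G$ the minima $UIVS(G)$ and $UIVXS(G)$ exist, and both can be computed in polynomial time: for each of them there are a Turing machine and a polynomial $p$ such that, given any triangle-free graph $G$ on $\{0,\dots,n-1\}$ (encoded as the word $1^n0$ followed by its adjacency matrix, row by row), the machine outputs the number in binary within $p(\ell)$ steps, where $\ell=n+1+n^2$ is the length of the input. -/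

import Mathlib

namespace VertexSplitting

universe u

/-- The graph obtained from `G` by splitting the vertex `v` along `A, B`: the vertex `v` is removed,
two new non-adjacent vertices `v₁ = Sum.inr false` and `v₂ = Sum.inr true` are added, `v₁` is joined
to the vertices of `A` and `v₂` to the vertices of `B`, and nothing else changes. It is used only
for `A ∪ B = N(v)`. -/
def splitGraph {V : Type u} (G : SimpleGraph V) (v : V) (A B : Set V) :
    SimpleGraph ({x : V // x ≠ v} ⊕ Bool) where
  Adj
    | Sum.inl x, Sum.inl y => G.Adj x.1 y.1
    | Sum.inl x, Sum.inr false => x.1 ∈ A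
    | Sum.inl x, Sum.inr true => x.1 ∈ B
    | Sum.inr false, Sum.inl x => x.1 ∈ A
    | Sum.inr true, Sum.inl x => x.1 ∈ B
    | Sum.inr _, Sum.inr _ => False
  symm := ⟨by
    rintro (x | _ | _) (y | _ | _) h
    · exact h.symm
    all_goals exact h⟩
  loopless := ⟨by
    rintro (x | _ | _) h
    · exact G.loopless.irrefl _ h
    all_goals exact h⟩

/-- `SplitSeq G k H`: some sequence of exactly `k` (inclusive) vertex splits turns `G` into `H`. -/
inductive SplitSeq : {V : Type u} → SimpleGraph V → ℕ → {W : Type u} → SimpleGraph W → Prop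
  | nil {V : Type u} (G : SimpleGraph V) : SplitSeq G 0 G
  | cons {V W : Type u} {G : SimpleGraph V} {H : SimpleGraph W} {k : ℕ} (v : V) (A B : Set V)
      (hAB : A ∪ B = G.neighborSet v) (h : SplitSeq (splitGraph G v A B) k H) :
      SplitSeq G (k + 1) H

/-- `ExclusiveSplitSeq G k H`: some sequence of exactly `k` exclusive vertex splits
turns `G` into `H`. -/
inductive ExclusiveSplitSeq :
    {V : Type u} → SimpleGraph V → ℕ → {W : Type u} → SimpleGraph W → Prop
  | nil {V : Type u} (G : SimpleGraph V) : ExclusiveSplitSeq G 0 G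
  | cons {V W : Type u} {G : SimpleGraph V} {H : SimpleGraph W} {k : ℕ} (v : V) (A B : Set V)
      (hAB : A ∪ B = G.neighborSet v) (hdisj : A ∩ B = ∅)
      (h : ExclusiveSplitSeq (splitGraph G v A B) k H) :
      ExclusiveSplitSeq G (k + 1) H

/-- A unit interval graph: the intersection graph of a family of intervals of length one on the
real line. -/
def IsUnitInterval {V : Type u} (G : SimpleGraph V) : Prop :=
  ∃ a : V → ℝ, ∀ x y : V, x ≠ y →
    (G.Adj x y ↔ (Set.Icc (a x) (a x + 1) ∩ Set.Icc (a y) (a y + 1)).Nonempty)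

/-- The lengths of the split sequences that turn `G` into a unit interval graph. -/
def unitIntervalSplitLengths {V : Type u} (G : SimpleGraph V) : Set ℕ :=
  {k | ∃ (W : Type u) (H : SimpleGraph W), SplitSeq G k H ∧ IsUnitInterval H}

/-- The lengths of the exclusive split sequences that turn `G` into a unit interval graph. -/
def unitIntervalExclusiveSplitLengths {V : Type u} (G : SimpleGraph V) : Set ℕ :=
  {k | ∃ (W : Type u) (H : SimpleGraph W), ExclusiveSplitSeq G k H ∧ IsUnitInterval H}

/-- The minimum length of a split sequence that turns `G` into a unit interval graph. -/
noncomputable def UIVS {V : Type u} (G : SimpleGraph V) : ℕ :=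
  sInf (unitIntervalSplitLengths G)

/-- The minimum length of an exclusive split sequence that turns `G` into a unit interval graph. -/
noncomputable def UIVXS {V : Type u} (G : SimpleGraph V) : ℕ :=
  sInf (unitIntervalExclusiveSplitLengths G)

/-- The inputs: triangle-free graphs with vertex set `{0, …, n - 1}`, for arbitrary `n`. -/
abbrev TriangleFreeGraph : Type :=
  Σ n : ℕ, {G : SimpleGraph (Fin n) // G.CliqueFree 3}

open Classical in
/-- The binary word that encodes a graph on `{0, …, n - 1}`: the word `1ⁿ0` followed by the
`n²` entries of the adjacency matrix, row by row. -/
noncomputable def encodeGraph {n : ℕ} (G : SimpleGraph (Fin n)) : List Bool :=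
  List.replicate n true ++ false ::
    (List.finRange n).flatMap fun i => (List.finRange n).map fun j => decide (G.Adj i j)

/-- `f`, a function of triangle-free graphs, is computable in polynomial time: some Turing machine,
given the encoding of any triangle-free graph `G`, writes `f G` in binary and halts
within a number of steps that is polynomial in the length of the encoding of `G`. -/
def PolyTimeOnTriangleFreeGraphs (f : TriangleFreeGraph → ℕ) : Prop :=
  Nonempty (Turing.TM2ComputableInPolyTime
    (fun G : TriangleFreeGraph => encodeGraph G.2.1) Computability.encodeNat f)

end VertexSplitting

/-! ### Even labelings and the rank -/

namespace VertexSplitting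
universe u
variable {V : Type u}

/-! `evenLabelings G` is a vector space over the field with two elements, with one dimension for
every component all of whose degrees are even, isolated vertices included. Hence `splitRank G` is
the sum of ⌈deg/2⌉ plus the number of such components. Each split adds exactly one vertex, and both
minima turn out to be `splitRank G` minus the number of vertices.

Lower bound: a split never lowers the rank (`splitRank_le_splitGraph`), because a lost dimension is
paid for by a larger half degree. Splits preserve triangle-freeness, and a triangle-free unit
interval graph has rank at most its number of vertices (`splitRank_le_card_of_isUnitInterval`).

Upper bound: as long as some degree exceeds two or some nontrivial component is even, an exclusive
split keeps the rank (`exists_split_of_not_splitIrreducible`). The rank is never below the number of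
vertices (`card_le_splitRank`), so this stops; the final graph is a union of paths and can be laid
out on the line (`SplitIrreducible.isUnitInterval`).

Computation: eliminating the vertices one by one gives the dimension as n minus the number of pivots
(`ncard_solutions`), so the answer is the sum of half degrees minus the pivots. The machine keeps
this number in unary, with one decrement per pivot, and finally converts it to binary. -/

/-- The degree of a vertex. -/
noncomputable def deg (G : SimpleGraph V) (v : V) : ℕ := (G.neighborSet v).ncard

open Classical in
lemma ncard_eq_sum_ite [Fintype V] (A : Set V) : A.ncard = ∑ w, if w ∈ A then 1 else 0 := by
  rw [Set.ncard_eq_toFinset_card', Finset.sum_boole]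
  simp only [Nat.cast_id]
  congr 1
  ext; simp

open Classical in
lemma deg_eq_sum [Fintype V] (G : SimpleGraph V) (v : V) :
    deg G v = ∑ w, if G.Adj v w then 1 else 0 := by
  simp [deg, ncard_eq_sum_ite]

/-- The `0/1`-labelings that are constant along edges and vanish at the vertices of odd degree:
arbitrary unions of components without vertices of odd degree. -/
def evenLabelings (G : SimpleGraph V) : Set (V → Bool) :=
  {x | (∀ u v, G.Adj u v → x u = x v) ∧ ∀ v, Odd (deg G v) → x v = false}

/-- The number of vertices of a linear forest obtained from `G` by an optimal sequence of splits. -/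
noncomputable def splitRank (G : SimpleGraph V) : ℕ :=
  ∑ᶠ v, (deg G v + 1) / 2 + Nat.log 2 (evenLabelings G).ncard

lemma zero_mem_evenLabelings (G : SimpleGraph V) : (fun _ => false) ∈ evenLabelings G :=
  ⟨fun _ _ _ => rfl, fun _ _ => rfl⟩

lemma xor_mem_evenLabelings {G : SimpleGraph V} {x y : V → Bool} (hx : x ∈ evenLabelings G)
    (hy : y ∈ evenLabelings G) : (fun v => xor (x v) (y v)) ∈ evenLabelings G :=
  ⟨fun u v h => by simp only [hx.1 u v h, hy.1 u v h],
    fun v h => by simp only [hx.2 v h, hy.2 v h]; rfl⟩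

/-- Translation by `y` exchanges the labelings with value 0 and value 1 at `v`, so vanishing at `v`
costs exactly one dimension. -/
lemma ncard_evenLabelings_eq_two_mul [Finite V] {G : SimpleGraph V} {v : V} {y : V → Bool}
    (hy : y ∈ evenLabelings G) (hv : y v = true) :
    (evenLabelings G).ncard = 2 * {x ∈ evenLabelings G | x v = false}.ncard := by
  have h1 : evenLabelings G =
      {x ∈ evenLabelings G | x v = false} ∪ {x ∈ evenLabelings G | x v = true} := by
    ext x; constructor
    · intro h
      cases hx : x v
      · exact Or.inl ⟨h, hx⟩
      · exact Or.inr ⟨h, hx⟩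
    · rintro (h | h) <;> exact h.1
  have hd : Disjoint {x ∈ evenLabelings G | x v = false} {x ∈ evenLabelings G | x v = true} := by
    rw [Set.disjoint_left]; rintro x ⟨_, h⟩ ⟨_, h'⟩; simp [h] at h'
  have hinj : Function.Injective fun (x : V → Bool) u => xor (x u) (y u) := by
    intro x x' h; funext u
    have := congrFun h u
    simpa using this
  have h2 : (fun (x : V → Bool) u => xor (x u) (y u)) '' {x ∈ evenLabelings G | x v = false} =
      {x ∈ evenLabelings G | x v = true} := by
    ext x; constructor
    · rintro ⟨z, ⟨hz, hz'⟩, rfl⟩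
      exact ⟨xor_mem_evenLabelings hz hy, by simp [hz', hv]⟩
    · rintro ⟨hx, hx'⟩
      refine ⟨fun u => xor (x u) (y u), ⟨xor_mem_evenLabelings hx hy, by simp [hx', hv]⟩, ?_⟩
      funext u; simp
  have h3 := congrArg Set.ncard h1
  rw [Set.ncard_union_eq hd (Set.toFinite _) (Set.toFinite _), ← h2,
    Set.ncard_image_of_injective _ hinj] at h3
  omega

/-! ### The effect of a split on degrees, labelings and rank -/

/-- Merging the two copies is a graph homomorphism; triangle-freeness and labelings are transported
along it. -/
lemma splitGraph_adj_collapse {G : SimpleGraph V} {v : V} {A B : Set V}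
    (hAB : A ∪ B = G.neighborSet v) {s t : {x : V // x ≠ v} ⊕ Bool}
    (h : (splitGraph G v A B).Adj s t) :
    G.Adj (Sum.elim Subtype.val (fun _ => v) s) (Sum.elim Subtype.val (fun _ => v) t) := by
  have hA : ∀ u ∈ A, G.Adj v u := fun u hu => by
    have : u ∈ G.neighborSet v := hAB ▸ Or.inl hu
    exact this
  have hB : ∀ u ∈ B, G.Adj v u := fun u hu => by
    have : u ∈ G.neighborSet v := hAB ▸ Or.inr hu
    exact this
  rcases s with s | _ | _ <;> rcases t with t | _ | _
  · exact h
  · exact (hA _ h).symm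
  · exact (hB _ h).symm
  · exact hA _ h
  · exact h.elim
  · exact h.elim
  · exact hB _ h
  · exact h.elim
  · exact h.elim

lemma cliqueFree_three_iff (G : SimpleGraph V) :
    G.CliqueFree 3 ↔ ∀ a b c, G.Adj a b → G.Adj a c → G.Adj b c → False := by
  classical
  constructor
  · intro h a b c h1 h2 h3
    exact h {a, b, c} (SimpleGraph.is3Clique_triple_iff.2 ⟨h1, h2, h3⟩)
  · intro h s hs
    obtain ⟨a, b, c, h1, h2, h3, -⟩ := SimpleGraph.is3Clique_iff.1 hs
    exact h a b c h1 h2 h3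

lemma cliqueFree_splitGraph {G : SimpleGraph V} (hG : G.CliqueFree 3) {v : V} {A B : Set V}
    (hAB : A ∪ B = G.neighborSet v) : (splitGraph G v A B).CliqueFree 3 := by
  rw [cliqueFree_three_iff] at *
  intro a b c h1 h2 h3
  exact hG _ _ _ (splitGraph_adj_collapse hAB h1) (splitGraph_adj_collapse hAB h2)
    (splitGraph_adj_collapse hAB h3)

lemma not_mem_of_union_eq {G : SimpleGraph V} {v : V} {A B : Set V}
    (hAB : A ∪ B = G.neighborSet v) : v ∉ A ∧ v ∉ B := by
  have : v ∉ A ∪ B := by rw [hAB]; simp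
  simpa using this

section SplitDegrees
variable {G : SimpleGraph V} {v : V} {A B : Set V}

open Classical in
lemma deg_splitGraph_inl [Finite V] (hAB : A ∪ B = G.neighborSet v) (u : {x : V // x ≠ v}) :
    deg (splitGraph G v A B) (Sum.inl u) = deg G u + if u.1 ∈ A ∩ B then 1 else 0 := by
  cases nonempty_fintype V
  have h : G.Adj u v ↔ u.1 ∈ A ∨ u.1 ∈ B := by
    rw [G.adj_comm, ← SimpleGraph.mem_neighborSet, ← hAB]; rfl
  rw [deg_eq_sum, deg_eq_sum, Fintype.sum_sum_type, Fintype.sum_bool,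
    Fintype.sum_eq_add_sum_subtype_ne _ v]
  simp only [h, splitGraph, Set.mem_inter_iff]
  by_cases h1 : u.1 ∈ A <;> by_cases h2 : u.1 ∈ B <;>
    simp only [h1, h2, if_true, if_false, or_true, or_false, and_true, and_false] <;>
    ring_nf <;> congr!

lemma deg_splitGraph_inr_false [Finite V] (hAB : A ∪ B = G.neighborSet v) :
    deg (splitGraph G v A B) (Sum.inr false) = A.ncard := by
  classical
  cases nonempty_fintype V
  rw [deg_eq_sum, ncard_eq_sum_ite, Fintype.sum_sum_type, Fintype.sum_bool,
    Fintype.sum_eq_add_sum_subtype_ne _ v]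
  simp only [splitGraph, (not_mem_of_union_eq hAB).1, if_false, zero_add]
  simp [-Finset.sum_boole]
  congr!

lemma deg_splitGraph_inr_true [Finite V] (hAB : A ∪ B = G.neighborSet v) :
    deg (splitGraph G v A B) (Sum.inr true) = B.ncard := by
  classical
  cases nonempty_fintype V
  rw [deg_eq_sum, ncard_eq_sum_ite, Fintype.sum_sum_type, Fintype.sum_bool,
    Fintype.sum_eq_add_sum_subtype_ne _ v]
  simp only [splitGraph, (not_mem_of_union_eq hAB).2, if_false, zero_add]
  simp [-Finset.sum_boole]
  congr!

open Classical in
lemma finsum_splitGraph [Fintype V] (hAB : A ∪ B = G.neighborSet v) :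
    ∑ᶠ s, (deg (splitGraph G v A B) s + 1) / 2 = (A.ncard + 1) / 2 + (B.ncard + 1) / 2 +
      ∑ u : {x : V // x ≠ v}, (deg G u + (if u.1 ∈ A ∩ B then 1 else 0) + 1) / 2 := by
  rw [finsum_eq_sum_of_fintype, Fintype.sum_sum_type, Fintype.sum_bool]
  simp only [deg_splitGraph_inl hAB, deg_splitGraph_inr_false hAB, deg_splitGraph_inr_true hAB]
  ring

open Classical in
lemma finsum_eq_add [Fintype V] (G : SimpleGraph V) (v : V) :
    ∑ᶠ s, (deg G s + 1) / 2 = (deg G v + 1) / 2 +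
      ∑ u : {x : V // x ≠ v}, (deg G u + 1) / 2 := by
  rw [finsum_eq_sum_of_fintype, Fintype.sum_eq_add_sum_subtype_ne _ v]

lemma finsum_splitGraph_of_disjoint [Finite V] (hAB : A ∪ B = G.neighborSet v) (hd : A ∩ B = ∅) :
    ∑ᶠ s, (deg (splitGraph G v A B) s + 1) / 2 + (deg G v + 1) / 2 =
      ∑ᶠ s, (deg G s + 1) / 2 + ((A.ncard + 1) / 2 + (B.ncard + 1) / 2) := by
  classical
  cases nonempty_fintype V
  rw [finsum_splitGraph hAB, finsum_eq_add G v]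
  simp only [hd, Set.mem_empty_iff_false, if_false, add_zero]
  ring

lemma deg_eq_add_of_disjoint [Finite V] (hAB : A ∪ B = G.neighborSet v) (hd : A ∩ B = ∅) :
    deg G v = A.ncard + B.ncard := by
  rw [deg, ← hAB, Set.ncard_union_eq (Set.disjoint_iff_inter_eq_empty.2 hd)]

/-- Only the two copies and the common neighbors in `A ∩ B` can acquire a new odd degree. A labeling
that vanishes at `v` vanishes at all of these; in the other case none of them is odd because of the
split. -/
lemma lift_mem_evenLabelings [Finite V] (hAB : A ∪ B = G.neighborSet v) {x : V → Bool}
    (hx : x ∈ evenLabelings G)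
    (h : x v = false ∨ (A ∩ B = ∅ ∧ Even A.ncard ∧ Even B.ncard)) :
    (fun s => x (Sum.elim Subtype.val (fun _ => v) s)) ∈ evenLabelings (splitGraph G v A B) := by
  classical
  refine ⟨fun s t hst => hx.1 _ _ (splitGraph_adj_collapse hAB hst), ?_⟩
  rintro (u | _ | _) hodd
  · rw [deg_splitGraph_inl hAB] at hodd
    by_cases hu : u.1 ∈ A ∩ B
    · rcases h with h | h
      · have : G.Adj v u := by
          have : u.1 ∈ G.neighborSet v := hAB ▸ Or.inl hu.1
          exact this
        simpa [← hx.1 _ _ this] using h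
      · simp [h.1] at hu
    · rw [if_neg hu, add_zero] at hodd
      exact hx.2 _ hodd
  · rw [deg_splitGraph_inr_false hAB] at hodd
    rcases h with h | h
    · exact h
    · exact absurd h.2.1 (Nat.not_even_iff_odd.2 hodd)
  · rw [deg_splitGraph_inr_true hAB] at hodd
    rcases h with h | h
    · exact h
    · exact absurd h.2.2 (Nat.not_even_iff_odd.2 hodd)

lemma lift_injective (v : V) : Function.Injective
    fun (x : V → Bool) (s : {x : V // x ≠ v} ⊕ Bool) =>
      x (Sum.elim Subtype.val (fun _ => v) s) := by
  intro x y h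
  funext u
  by_cases hu : u = v
  · subst hu; exact congrFun h (Sum.inr true)
  · exact congrFun h (Sum.inl ⟨u, hu⟩)

/-- If all labelings lift, no term falls, since ⌈·/2⌉ is subadditive. Otherwise those vanishing at
`v` still lift, so at most one dimension is lost, and the half degrees must make up for it. -/
theorem splitRank_le_splitGraph [Finite V] (hAB : A ∪ B = G.neighborSet v) :
    splitRank G ≤ splitRank (splitGraph G v A B) := by
  classical
  cases nonempty_fintype V
  have hdeg : deg G v ≤ A.ncard + B.ncard := by
    rw [deg, ← hAB]; exact Set.ncard_union_le _ _
  have hsum : ∀ u : {x : V // x ≠ v}, u ∈ Finset.univ →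
      (deg G u + 1) / 2 ≤ (deg G u + (if u.1 ∈ A ∩ B then 1 else 0) + 1) / 2 :=
    fun u _ => Nat.div_le_div_right (by omega)
  unfold splitRank
  rw [finsum_splitGraph hAB, finsum_eq_add G v]
  by_cases h : (∀ x ∈ evenLabelings G, x v = false) ∨
      (A ∩ B = ∅ ∧ Even A.ncard ∧ Even B.ncard)
  · have h1 : (evenLabelings G).ncard ≤ (evenLabelings (splitGraph G v A B)).ncard :=
      Set.ncard_le_ncard_of_injOn _
        (fun x hx => lift_mem_evenLabelings hAB hx (h.imp_left fun h => h x hx))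
        (lift_injective v).injOn (Set.toFinite _)
    have h2 := Nat.log_mono_right (b := 2) h1
    have h3 := Finset.sum_le_sum hsum
    omega
  · push Not at h
    obtain ⟨⟨y, hy, hyv⟩, hne⟩ := h
    simp only [ne_eq, Bool.not_eq_false] at hyv
    have h1 : {x ∈ evenLabelings G | x v = false}.ncard ≤
        (evenLabelings (splitGraph G v A B)).ncard :=
      Set.ncard_le_ncard_of_injOn _
        (fun x hx => lift_mem_evenLabelings hAB hx.1 (Or.inl hx.2))
        (lift_injective v).injOn (Set.toFinite _)
    have h2 := Nat.log_mono_right (b := 2) h1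
    have hpos : {x ∈ evenLabelings G | x v = false}.ncard ≠ 0 :=
      Set.ncard_ne_zero_of_mem (a := fun _ => false) ⟨zero_mem_evenLabelings G, rfl⟩
    rw [ncard_evenLabelings_eq_two_mul hy hyv, mul_comm,
      Nat.log_mul_base (by norm_num) hpos]
    by_cases hd : A ∩ B = ∅
    -- The label 1 at `v` makes its degree even, so both parts are odd and rounding up gains one.
    · have hev : ¬ Odd (deg G v) := fun h => by simp [hy.2 v h] at hyv
      have hdd := deg_eq_add_of_disjoint hAB hd
      have hodd := hne hd
      have h3 := Finset.sum_le_sum hsum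
      rw [Nat.not_odd_iff_even] at hev
      simp only [Nat.even_iff] at *
      omega
    -- A common neighbor `u` shares the label of `v`, so its degree is even; one extra edge raises
    -- its half degree.
    · obtain ⟨u, hu⟩ := Set.nonempty_iff_ne_empty.2 hd
      have hadj : G.Adj v u := by
        have : u ∈ G.neighborSet v := hAB ▸ Or.inl hu.1
        exact this
      have hev : ¬ Odd (deg G u) := fun h => by
        rw [hy.1 _ _ hadj, hy.2 u h] at hyv; simp at hyv
      rw [Nat.not_odd_iff_even, Nat.even_iff] at hev
      have h3 := Finset.sum_lt_sum hsum ⟨⟨u, hadj.ne'⟩, Finset.mem_univ _, by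
        rw [if_pos hu]; dsimp only; omega⟩
      omega

/-- A labeling that agrees on both copies descends to `v`. If `v` has odd degree, one of the copies
is odd and forces the common value to be 0. -/
lemma unlift_mem_evenLabelings [Finite V] [DecidableEq V] (hAB : A ∪ B = G.neighborSet v) (hd : A ∩ B = ∅)
    {y : {x : V // x ≠ v} ⊕ Bool → Bool} (hy : y ∈ evenLabelings (splitGraph G v A B))
    (h : y (Sum.inr false) = y (Sum.inr true)) :
    (fun u => if hu : u = v then y (Sum.inr true) else y (Sum.inl ⟨u, hu⟩)) ∈ evenLabelings G := by
  classical
  have key : ∀ u (hu : u ≠ v), G.Adj v u → y (Sum.inl ⟨u, hu⟩) = y (Sum.inr true) := by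
    intro u hu huv
    have : u ∈ A ∪ B := by rw [hAB]; exact huv
    rcases this with h' | h'
    · rw [← h]; exact hy.1 _ _ h'
    · exact hy.1 _ _ h'
  refine ⟨fun s t hst => ?_, fun s hs => ?_⟩
  · by_cases h1 : s = v <;> by_cases h2 : t = v
    · simp [h1, h2]
    · subst h1; simp [h2, key t h2 hst]
    · subst h2; simp [h1, key s h1 hst.symm]
    · simp only [h1, h2, dif_neg, not_false_eq_true]
      exact hy.1 (Sum.inl ⟨s, h1⟩) (Sum.inl ⟨t, h2⟩) hst
  · by_cases h1 : s = v
    · subst h1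
      simp only [dif_pos]
      rw [deg_eq_add_of_disjoint hAB hd, Nat.odd_add] at hs
      by_cases ha : Odd A.ncard
      · rw [← h]; exact hy.2 _ (by rwa [deg_splitGraph_inr_false hAB])
      · refine hy.2 _ ?_
        rw [deg_splitGraph_inr_true hAB, ← Nat.not_even_iff_odd]
        tauto
    · simp only [h1, dif_neg, not_false_eq_true]
      refine hy.2 _ ?_
      rw [deg_splitGraph_inl hAB]
      simpa [hd] using hs

lemma unlift_injOn [DecidableEq V] (v : V) : Set.InjOn
    (fun (y : {x : V // x ≠ v} ⊕ Bool → Bool) (u : V) =>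
      if hu : u = v then y (Sum.inr true) else y (Sum.inl ⟨u, hu⟩))
    {y | y (Sum.inr false) = y (Sum.inr true)} := by
  intro y hy z hz h
  have h1 : y (Sum.inr true) = z (Sum.inr true) := by simpa using congrFun h v
  funext s
  rcases s with u | _ | _
  · simpa [u.2] using congrFun h u.1
  · rw [hy, hz, h1]
  · exact h1

end SplitDegrees

lemma card_splitGraph [Finite V] (v : V) :
    Nat.card ({x : V // x ≠ v} ⊕ Bool) = Nat.card V + 1 := by
  classical
  cases nonempty_fintype V
  have : 0 < Fintype.card V := Fintype.card_pos_iff.2 ⟨v⟩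
  simp only [Nat.card_eq_fintype_card, Fintype.card_sum, Fintype.card_bool,
    Fintype.card_subtype_compl, Fintype.card_unique, ne_eq]
  omega

/-! ### Triangle-free unit interval graphs -/

lemma isUnitInterval_iff (G : SimpleGraph V) :
    IsUnitInterval G ↔ ∃ a : V → ℝ, ∀ x y, x ≠ y → (G.Adj x y ↔ |a x - a y| ≤ 1) := by
  refine exists_congr fun a => forall₃_congr fun x y _ => ?_
  rw [Set.Icc_inter_Icc, Set.nonempty_Icc, abs_le]
  simp only [sup_le_iff, le_inf_iff]
  constructor
  · intro h
    refine h.trans ⟨fun h => ⟨by linarith [h.1.2], by linarith [h.2.1]⟩,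
      fun h => ⟨⟨by linarith, by linarith [h.1]⟩, by linarith [h.2], by linarith⟩⟩
  · intro h
    refine h.trans ⟨fun h => ⟨⟨by linarith, by linarith [h.1]⟩, by linarith [h.2], by linarith⟩,
      fun h => ⟨by linarith [h.1.2], by linarith [h.2.1]⟩⟩

/-- Two neighbors to the right of `w` lie in an interval of length one, so they would be adjacent
and close a triangle. -/
lemma eq_of_adj_of_le {G : SimpleGraph V} (hG : G.CliqueFree 3) {a : V → ℝ}
    (ha : ∀ x y, x ≠ y → (G.Adj x y ↔ |a x - a y| ≤ 1)) {w p q : V} (hp : G.Adj w p)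
    (hq : G.Adj w q) (hwp : a w ≤ a p) (hwq : a w ≤ a q) : p = q := by
  by_contra hpq
  refine (cliqueFree_three_iff G).1 hG w p q hp hq ((ha p q hpq).2 ?_)
  have h1 := abs_le.1 ((ha w p hp.ne).1 hp)
  have h2 := abs_le.1 ((ha w q hq.ne).1 hq)
  rw [abs_le]
  constructor <;> linarith [h1.1, h1.2, h2.1, h2.2]

lemma deg_le_two_of_unitInterval [Finite V] {G : SimpleGraph V} (hG : G.CliqueFree 3) {a : V → ℝ}
    (ha : ∀ x y, x ≠ y → (G.Adj x y ↔ |a x - a y| ≤ 1)) (w : V) : deg G w ≤ 2 := by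
  by_contra! h
  obtain ⟨p, q, r, hp, hq, hr, hpq, hpr, hqr⟩ := (Set.two_lt_ncard_iff (Set.toFinite _)).1 h
  have ha' : ∀ x y, x ≠ y → (G.Adj x y ↔ |(-a) x - (-a) y| ≤ 1) := fun x y hxy => by
    rw [ha x y hxy, ← abs_neg]
    simp only [Pi.neg_apply]
    ring_nf
  -- Distinct neighbors lie on different sides of `w`, the left side being handled by reflection;
  -- three neighbors cannot.
  have key : ∀ p q, p ≠ q → G.Adj w p → G.Adj w q → ¬ (a w ≤ a p ↔ a w ≤ a q) := by
    intro p q hpq hp hq hiff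
    by_cases hwp : a w ≤ a p
    · exact hpq (eq_of_adj_of_le hG ha hp hq hwp (hiff.1 hwp))
    · have hwq : ¬ a w ≤ a q := fun h => hwp (hiff.2 h)
      push Not at hwp hwq
      exact hpq (eq_of_adj_of_le hG ha' hp hq (by simpa using hwp.le) (by simpa using hwq.le))
  have h1 := key p q hpq hp hq
  have h2 := key p r hpr hp hr
  have h3 := key q r hqr hq hr
  tauto

open Classical in
-- A labeling is determined at the isolated vertices: a leftmost vertex of label 1 in a labeling
-- that vanishes there would have two neighbors to its right. Each vertex then contributes at most
-- one to the rank, by its half degree or by a free label.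
lemma splitRank_le_card_of_isUnitInterval [Finite V] {G : SimpleGraph V} (hG : G.CliqueFree 3)
    (h : IsUnitInterval G) : splitRank G ≤ Nat.card V := by
  cases nonempty_fintype V
  obtain ⟨a, ha⟩ := (isUnitInterval_iff G).1 h
  have hdeg := deg_le_two_of_unitInterval hG ha
  have hzero : ∀ x ∈ evenLabelings G, (∀ v, deg G v = 0 → x v = false) → ∀ v, x v = false := by
    intro x hx hiso
    by_contra! hne
    obtain ⟨w, hw, hmin⟩ := Set.exists_min_image {v | x v = true} a (Set.toFinite _)
      (by simpa [Set.Nonempty] using hne)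
    have hw : x w = true := hw
    have h0 : deg G w ≠ 0 := fun h0 => by simp [hiso w h0] at hw
    have h1 : ¬ Odd (deg G w) := fun h1 => by simp [hx.2 w h1] at hw
    have h2 : 1 < deg G w := by
      rw [Nat.not_odd_iff_even, Nat.even_iff] at h1; omega
    obtain ⟨p, q, hp, hq, hpq⟩ := (Set.one_lt_ncard_iff (Set.toFinite _)).1 h2
    exact hpq (eq_of_adj_of_le hG ha hp hq (hmin p ((hx.1 _ _ hp).symm.trans hw))
      (hmin q ((hx.1 _ _ hq).symm.trans hw)))
  have hcard : (evenLabelings G).ncard ≤ 2 ^ {v | deg G v = 0}.ncard := by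
    have : (2 : ℕ) ^ {v | deg G v = 0}.ncard =
        (Set.univ : Set ({v | deg G v = 0} → Bool)).ncard := by
      rw [Set.ncard_univ, Nat.card_fun, Nat.card_coe_set_eq]; simp
    rw [this]
    refine Set.ncard_le_ncard_of_injOn (fun x v => x v.1) (fun _ _ => Set.mem_univ _) ?_
      (Set.toFinite _)
    intro x hx y hy hxy
    funext v
    have := hzero _ (xor_mem_evenLabelings hx hy) (fun v hv => by
      have := congrFun hxy ⟨v, hv⟩
      simpa using this) v
    simpa using this
  have hlog : Nat.log 2 (evenLabelings G).ncard ≤ {v | deg G v = 0}.ncard := by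
    have := Nat.log_mono_right (b := 2) hcard
    rwa [Nat.log_pow (by norm_num)] at this
  have hsum : ∑ v, (deg G v + 1) / 2 + {v | deg G v = 0}.ncard ≤ Fintype.card V := by
    rw [ncard_eq_sum_ite, ← Finset.sum_add_distrib, Fintype.card_eq_sum_ones]
    refine Finset.sum_le_sum fun v _ => ?_
    have := hdeg v
    simp only [Set.mem_ofPred_eq]
    split_ifs <;> omega
  rw [splitRank, finsum_eq_sum_of_fintype, Nat.card_eq_fintype_card]
  omega

open Classical in
-- Isolated vertices can be labeled freely; every other vertex has half degree at least one.
lemma card_le_splitRank [Finite V] (G : SimpleGraph V) : Nat.card V ≤ splitRank G := by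
  cases nonempty_fintype V
  have hcard : 2 ^ {v | deg G v = 0}.ncard ≤ (evenLabelings G).ncard := by
    have : (2 : ℕ) ^ {v | deg G v = 0}.ncard =
        (Set.univ : Set ({v | deg G v = 0} → Bool)).ncard := by
      rw [Set.ncard_univ, Nat.card_fun, Nat.card_coe_set_eq]; simp
    rw [this]
    refine Set.ncard_le_ncard_of_injOn
      (fun x v => if h : deg G v = 0 then x ⟨v, h⟩ else false) ?_ ?_ (Set.toFinite _)
    · intro x _
      have hadj : ∀ u v, G.Adj u v → deg G u ≠ 0 := fun u v h =>
        Set.ncard_ne_zero_of_mem (a := v) h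
      refine ⟨fun u v h => by simp [hadj u v h, hadj v u h.symm], fun v hv => ?_⟩
      have : deg G v ≠ 0 := by rintro h; simp [h] at hv
      simp [this]
    · intro x _ y _ hxy
      funext ⟨v, hv⟩
      have := congrFun hxy v
      have hv' : deg G v = 0 := hv
      simpa [hv'] using this
  have hlog : {v | deg G v = 0}.ncard ≤ Nat.log 2 (evenLabelings G).ncard := by
    have := Nat.log_mono_right (b := 2) hcard
    rwa [Nat.log_pow (by norm_num)] at this
  have hsum : Fintype.card V ≤ ∑ v, (deg G v + 1) / 2 + {v | deg G v = 0}.ncard := by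
    rw [ncard_eq_sum_ite, ← Finset.sum_add_distrib, Fintype.card_eq_sum_ones]
    refine Finset.sum_le_sum fun v _ => ?_
    simp only [Set.mem_ofPred_eq]
    split_ifs <;> omega
  rw [splitRank, finsum_eq_sum_of_fintype, Nat.card_eq_fintype_card]
  omega

/-! ### SplitIrreducible graphs are unit interval graphs -/

/-- A realization on the real line in which distinct vertices have distance at least one. -/
def IsLayout (G : SimpleGraph V) (a : V → ℝ) : Prop :=
  ∀ x y, x ≠ y → 1 ≤ |a x - a y| ∧ (G.Adj x y ↔ |a x - a y| ≤ 1)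

lemma IsLayout.neg {G : SimpleGraph V} {a : V → ℝ} (h : IsLayout G a) : IsLayout G (-a) := by
  intro x y hxy
  have : |(-a) x - (-a) y| = |a x - a y| := by
    rw [← abs_neg]; simp only [Pi.neg_apply]; ring_nf
  rw [this]; exact h x y hxy

/-- The graph `G` without the edges at `u`. -/
def isolate (G : SimpleGraph V) (u : V) : SimpleGraph V where
  Adj x y := G.Adj x y ∧ x ≠ u ∧ y ≠ u
  symm := ⟨fun _ _ h => ⟨h.1.symm, h.2.2, h.2.1⟩⟩
  loopless := ⟨fun _ h => h.1.ne rfl⟩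

/-- Everything to the right of `w` moves by two, and `u` goes one unit to the right of `w`. No edge
is torn: by separation none can jump over `w`, and by `hw` none leaves `w` to the right. -/
lemma IsLayout.attach_leaf {G : SimpleGraph V} {u w : V} (huw : G.Adj u w)
    (hu : ∀ x, G.Adj u x → x = w) {a : V → ℝ} (ha : IsLayout (isolate G u) a)
    (hw : ∀ x, x ≠ u → G.Adj w x → a x ≤ a w) : ∃ b, IsLayout G b := by
  classical
  refine ⟨fun x => if x = u then a w + 1 else if a w < a x then a x + 2 else a x, ?_⟩
  have hwu : w ≠ u := huw.ne'
  have hsep : ∀ x y, x ≠ y → a x ≤ a y → 1 ≤ a y - a x := fun x y hxy h => by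
    have := (ha x y hxy).1
    rwa [abs_sub_comm, abs_of_nonneg (by linarith)] at this
  have key : ∀ y, y ≠ u → 1 ≤ |(a w + 1) - (if a w < a y then a y + 2 else a y)| ∧
      (G.Adj u y ↔ |(a w + 1) - (if a w < a y then a y + 2 else a y)| ≤ 1) := by
    intro y hy
    by_cases hyw : y = w
    · subst hyw; simp [huw]
    · have hn : ¬ G.Adj u y := fun h => hyw (hu y h)
      simp only [hn, false_iff, not_le]
      suffices 1 < |(a w + 1) - (if a w < a y then a y + 2 else a y)| from ⟨this.le, this⟩
      split_ifs with h
      · rw [lt_abs]; right; linarith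
      · have := hsep y w hyw (not_lt.1 h)
        rw [lt_abs]; left; linarith
  have key2 : ∀ x y, x ≠ u → y ≠ u → x ≠ y → a x ≤ a y →
      1 ≤ |(if a w < a x then a x + 2 else a x) - (if a w < a y then a y + 2 else a y)| ∧
      (G.Adj x y ↔
        |(if a w < a x then a x + 2 else a x) - (if a w < a y then a y + 2 else a y)| ≤ 1) := by
    intro x y hx hy hxy hle
    have h1 := ha x y hxy
    have h2 : (isolate G u).Adj x y ↔ G.Adj x y := ⟨fun h => h.1, fun h => ⟨h, hx, hy⟩⟩
    rw [h2] at h1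
    split_ifs with h3 h4 h4
    · rwa [add_sub_add_right_eq_sub]
    · exact absurd (lt_of_lt_of_le h3 hle) h4
    · have hn : ¬ G.Adj x y := by
        intro hadj
        by_cases hxw : x = w
        · subst hxw; linarith [hw y hy hadj]
        · have h5 := hsep x w hxw (not_lt.1 h3)
          have h6 := abs_le.1 (h1.2.1 hadj)
          linarith [h6.1]
      simp only [hn, false_iff, not_le]
      suffices 1 < |a x - (a y + 2)| from ⟨this.le, this⟩
      rw [lt_abs]; right; linarith
    · exact h1
  intro x y hxy
  by_cases hx : x = u <;> by_cases hy : y = u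
  · exact absurd (hx.trans hy.symm) hxy
  · subst hx; simp only [if_true, hy, if_false]; exact key y hy
  · subst hy
    simp only [if_true, hx, if_false]
    rw [abs_sub_comm, G.adj_comm]; exact key x hx
  · simp only [hx, hy, if_false]
    rcases le_total (a x) (a y) with h | h
    · exact key2 x y hx hy hxy h
    · rw [abs_sub_comm, G.adj_comm]; exact key2 y x hy hx hxy.symm h

/-- A graph of maximum degree at most two in which every nontrivial component has a vertex
of odd degree. -/
def SplitIrreducible (G : SimpleGraph V) : Prop :=
  (∀ v, deg G v ≤ 2) ∧ ∀ x ∈ evenLabelings G, ∀ v, x v = true → deg G v = 0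

lemma deg_isolate_self (G : SimpleGraph V) (u : V) : deg (isolate G u) u = 0 := by
  have : (isolate G u).neighborSet u = ∅ := by
    ext x; simp [isolate]
  rw [deg, this, Set.ncard_empty]

lemma deg_isolate_of_not_adj {G : SimpleGraph V} {u x : V} (hx : x ≠ u) (h : ¬ G.Adj u x) :
    deg (isolate G u) x = deg G x := by
  have : (isolate G u).neighborSet x = G.neighborSet x := by
    ext y
    simp only [isolate, SimpleGraph.mem_neighborSet, and_iff_left_iff_imp]
    rintro hxy
    exact ⟨hx, fun h' => h (h' ▸ hxy.symm)⟩
  rw [deg, deg, this]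

lemma deg_isolate_of_adj [Finite V] {G : SimpleGraph V} {u x : V} (h : G.Adj u x) :
    deg (isolate G u) x + 1 = deg G x := by
  have : (isolate G u).neighborSet x = G.neighborSet x \ {u} := by
    ext y
    simp [isolate, h.ne']
  rw [deg, deg, this]
  exact Set.ncard_sdiff_singleton_add_one h.symm (Set.toFinite _)

/-- The neighbor `w` ends with degree 0 or 1, so its label vanishes unless it is isolated. A
labeling of the smaller graph, reset to 0 at `u` and `w`, is therefore one of `G`. -/
lemma SplitIrreducible.isolate_leaf [Finite V] {G : SimpleGraph V} (hG : SplitIrreducible G) {u w : V}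
    (huw : G.Adj u w) (hu : ∀ x, G.Adj u x → x = w) : SplitIrreducible (isolate G u) := by
  classical
  have hwu : w ≠ u := huw.ne'
  have hdeg : ∀ x, x ≠ u → x ≠ w → deg (isolate G u) x = deg G x :=
    fun x hx hxw => deg_isolate_of_not_adj hx fun h => hxw (hu x h)
  have hdw := deg_isolate_of_adj huw
  have hw2 := hG.1 w
  have hle : ∀ x, deg (isolate G u) x ≤ deg G x := by
    intro x
    by_cases hx : x = u
    · subst hx; simp [deg_isolate_self]
    · by_cases hxw : x = w
      · subst hxw; omega
      · exact (hdeg x hx hxw).le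
  refine ⟨fun v => (hle v).trans (hG.1 v), ?_⟩
  intro x hx t ht
  have hxw : deg (isolate G u) w ≠ 0 → x w = false := fun h => by
    refine hx.2 w ?_
    have : deg (isolate G u) w = 1 := by omega
    rw [this]; exact odd_one
  by_contra h0
  have htu : t ≠ u := by rintro rfl; exact h0 (deg_isolate_self _ _)
  have htw : t ≠ w := by rintro rfl; simp [hxw h0] at ht
  have hmem : (fun s => if s = u ∨ s = w then false else x s) ∈ evenLabelings G := by
    have hwadj : ∀ s, s ≠ u → G.Adj w s → x s = false := by
      intro s hs hws
      have hadj : (isolate G u).Adj w s := ⟨hws, hwu, hs⟩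
      rw [← hx.1 _ _ hadj]
      exact hxw (Set.ncard_ne_zero_of_mem (a := s) hadj)
    refine ⟨fun s t hst => ?_, fun s hs => ?_⟩
    · by_cases h1 : s = u
      · subst h1; simp [hu t hst]
      by_cases h2 : t = u
      · subst h2; simp [hu s hst.symm]
      by_cases h3 : s = w
      · subst h3; simp [hwadj t h2 hst]
      by_cases h4 : t = w
      · subst h4; simp [hwadj s h1 hst.symm]
      simp only [h1, h2, h3, h4, or_self, if_false]
      exact hx.1 _ _ ⟨hst, h1, h2⟩
    · by_cases h1 : s = u
      · simp [h1]
      by_cases h3 : s = w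
      · simp [h3]
      simp only [h1, h3, or_self, if_false]
      exact hx.2 s (by rwa [hdeg s h1 h3])
  have := hG.2 _ hmem t (by simp [htu, htw, ht])
  have := hle t
  omega

lemma exists_layout_of_edgeless [Finite V] {G : SimpleGraph V} (h : ∀ x y, ¬ G.Adj x y) :
    ∃ a, IsLayout G a := by
  cases nonempty_fintype V
  refine ⟨fun x => 2 * ((Fintype.equivFin V x : ℕ) : ℝ), fun x y hxy => ?_⟩
  have hne : ((Fintype.equivFin V x : ℕ) : ℤ) - (Fintype.equivFin V y : ℕ) ≠ 0 := by
    intro h0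
    apply hxy
    apply (Fintype.equivFin V).injective
    apply Fin.ext
    omega
  have h1 := Int.one_le_abs hne
  have h2 : (1 : ℝ) ≤ |((Fintype.equivFin V x : ℕ) : ℝ) - (Fintype.equivFin V y : ℕ)| := by
    exact_mod_cast h1
  rw [← mul_sub, abs_mul, abs_two]
  simp only [h, false_iff, not_le]
  constructor <;> linarith

/-- Leaves are removed by induction on the number of non-isolated vertices. Without leaves all
degrees are 0 or 2, and labeling every non-isolated vertex by 1 shows that there are no edges. -/
lemma SplitIrreducible.exists_layout [Finite V] {G : SimpleGraph V} (hG : SplitIrreducible G) :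
    ∃ a, IsLayout G a := by
  induction hn : {v | deg G v ≠ 0}.ncard using Nat.strong_induction_on generalizing G with
  | _ n ih =>
  by_cases hleaf : ∃ u, deg G u = 1
  · obtain ⟨u, hu⟩ := hleaf
    obtain ⟨w, hw⟩ := Set.ncard_eq_one.1 hu
    have hadj : ∀ x, G.Adj u x ↔ x = w := fun x => by
      rw [← SimpleGraph.mem_neighborSet, hw, Set.mem_singleton_iff]
    have huw : G.Adj u w := (hadj w).2 rfl
    have hlt : {v | deg (isolate G u) v ≠ 0}.ncard < n := by
      rw [← hn]
      refine Set.ncard_lt_ncard ?_ (Set.toFinite _)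
      refine Set.ssubset_iff_exists.2 ⟨fun v hv => ?_, u, ?_, ?_⟩
      · intro h0
        apply hv
        by_cases hvu : v = u
        · rw [hvu, deg_isolate_self]
        · by_cases hvw : G.Adj u v
          · have := deg_isolate_of_adj hvw
            omega
          · rw [deg_isolate_of_not_adj hvu hvw, h0]
      · simp [hu]
      · simp [deg_isolate_self]
    obtain ⟨a, ha⟩ := ih _ hlt (hG.isolate_leaf huw fun x => (hadj x).1) rfl
    have huniq : ∀ x y, x ≠ u → y ≠ u → G.Adj w x → G.Adj w y → x = y := by
      intro x y hx hy hwx hwy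
      have h1 := deg_isolate_of_adj huw
      have h2 := hG.1 w
      have h3 : ((isolate G u).neighborSet w).ncard ≤ 1 := by
        change deg (isolate G u) w ≤ 1; omega
      exact (Set.ncard_le_one (Set.toFinite _)).1 h3 x ⟨hwx, huw.ne', hx⟩ y ⟨hwy, huw.ne', hy⟩
    by_cases hright : ∀ x, x ≠ u → G.Adj w x → a x ≤ a w
    · exact ha.attach_leaf huw (fun x => (hadj x).1) hright
    · push Not at hright
      obtain ⟨s, hs, hws, hlt⟩ := hright
      -- The only other neighbor of `w` is on the right; reflection brings it to the left.
      refine ha.neg.attach_leaf huw (fun x => (hadj x).1) fun x hx hwx => ?_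
      rw [huniq x s hx hs hwx hws]
      simpa using hlt.le
  · push Not at hleaf
    refine exists_layout_of_edgeless fun x y hxy => ?_
    classical
    have hmem : (fun v => decide (deg G v ≠ 0)) ∈ evenLabelings G := by
      refine ⟨fun u v h => ?_, fun v hv => ?_⟩
      · have h1 : deg G u ≠ 0 := Set.ncard_ne_zero_of_mem (a := v) h
        have h2 : deg G v ≠ 0 := Set.ncard_ne_zero_of_mem (a := u) h.symm
        simp [h1, h2]
      · have h1 := hG.1 v
        have h2 := hleaf v
        have h3 := Nat.odd_iff.1 hv
        omega
    have h1 : deg G x ≠ 0 := Set.ncard_ne_zero_of_mem (a := y) hxy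
    exact h1 (hG.2 _ hmem x (by simpa using h1))

lemma SplitIrreducible.isUnitInterval [Finite V] {G : SimpleGraph V} (hG : SplitIrreducible G) :
    IsUnitInterval G := by
  obtain ⟨a, ha⟩ := hG.exists_layout
  exact (isUnitInterval_iff G).2 ⟨a, fun x y hxy => (ha x y hxy).2⟩

/-! ### Splits that preserve the rank -/

section Reduce
variable [Finite V] {G : SimpleGraph V} {v : V}

/-- Both parts are odd, so the half degrees gain one; the odd copies force the label 0, which costs
one dimension. -/
lemma splitRank_split_neighbor_le {x : V → Bool} (hx : x ∈ evenLabelings G) (hxv : x v = true)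
    {p : V} (hp : G.Adj v p) :
    splitRank (splitGraph G v {p} (G.neighborSet v \ {p})) ≤ splitRank G := by
  classical
  have hAB : {p} ∪ (G.neighborSet v \ {p}) = G.neighborSet v := by
    rw [Set.union_sdiff_self, Set.union_eq_right, Set.singleton_subset_iff]; exact hp
  have hd : {p} ∩ (G.neighborSet v \ {p}) = ∅ := Set.inter_sdiff_self _ _
  have hsum := finsum_splitGraph_of_disjoint hAB hd
  have hdeg := deg_eq_add_of_disjoint hAB hd
  rw [Set.ncard_singleton] at hsum hdeg
  have hev : ¬ Odd (deg G v) := fun h => by simp [hx.2 v h] at hxv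
  rw [Nat.not_odd_iff_even, Nat.even_iff] at hev
  have hf : ∀ y ∈ evenLabelings (splitGraph G v {p} (G.neighborSet v \ {p})),
      y (Sum.inr false) = false ∧ y (Sum.inr true) = false := by
    intro y hy
    constructor
    · refine hy.2 _ ?_
      rw [deg_splitGraph_inr_false hAB, Set.ncard_singleton]; exact odd_one
    · refine hy.2 _ ?_
      rw [deg_splitGraph_inr_true hAB, Nat.odd_iff]; omega
  have h1 : (evenLabelings (splitGraph G v {p} (G.neighborSet v \ {p}))).ncard ≤
      {x ∈ evenLabelings G | x v = false}.ncard := by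
    refine Set.ncard_le_ncard_of_injOn _ (fun y hy => ⟨unlift_mem_evenLabelings hAB hd hy ?_, ?_⟩)
      ((unlift_injOn v).mono fun y hy => ?_) (Set.toFinite _)
    · rw [(hf y hy).1, (hf y hy).2]
    · simp [(hf y hy).2]
    · simp [(hf y hy).1, (hf y hy).2]
  have hpos : {x ∈ evenLabelings G | x v = false}.ncard ≠ 0 :=
    Set.ncard_ne_zero_of_mem (a := fun _ => false) ⟨zero_mem_evenLabelings G, rfl⟩
  have h2 := Nat.log_mono_right (b := 2) h1
  rw [splitRank, splitRank, ncard_evenLabelings_eq_two_mul hx hxv, mul_comm,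
    Nat.log_mul_base (by norm_num) hpos]
  omega

/-- Handshaking in the graph of edges with a labeled end: away from `v`, labeled vertices keep their
even degree and unlabeled ones become isolated, so the degree of `v` is even as well. -/
lemma even_ncard_neighbors_of_label {z : V → Bool} (hzv : z v = false)
    (hz : ∀ a b, a ≠ v → b ≠ v → G.Adj a b → z a = z b)
    (hodd : ∀ a, a ≠ v → Odd (deg G a) → z a = false) :
    Even {u | G.Adj v u ∧ z u = true}.ncard := by
  classical
  cases nonempty_fintype V
  let H : SimpleGraph V :=
    { Adj := fun a b => G.Adj a b ∧ (z a = true ∨ z b = true)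
      symm := ⟨fun _ _ h => ⟨h.1.symm, h.2.symm⟩⟩
      loopless := ⟨fun _ h => h.1.ne rfl⟩ }
  have hH : ∀ a, H.degree a = (H.neighborSet a).ncard := fun a => by
    rw [← SimpleGraph.card_neighborSet_eq_degree, Set.ncard_eq_toFinset_card',
      Set.toFinset_card]
  have hv : H.neighborSet v = {u | G.Adj v u ∧ z u = true} := by
    ext u; simp [H, hzv]
  rw [← hv, ← hH, ← Nat.not_odd_iff_even]
  intro hv
  obtain ⟨w, hwv, hw⟩ := H.exists_ne_odd_degree_of_exists_odd_degree v hv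
  rw [hH] at hw
  by_cases hzw : z w = true
  · have : H.neighborSet w = G.neighborSet w := by
      ext u; simp [H, hzw]
    rw [this] at hw
    simp [hodd w hwv hw] at hzw
  · have : H.neighborSet w = ∅ := by
      ext u
      simp only [SimpleGraph.mem_neighborSet, H, hzw, Set.mem_empty_iff_false, iff_false]
      rintro ⟨h1, h2⟩
      simp only [Bool.false_eq_true, false_or] at h2
      have huv : u ≠ v := by rintro rfl; simp [hzv] at h2
      exact hzw ((hz w u hwv huv h1).trans h2)
    rw [this] at hw
    simp at hw

/-- The two copies carry different labels, and these spread to their neighbors; so off `v` the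
labeling separates `A` from the rest of the neighborhood. -/
lemma exists_label_of_ne {A : Set V} (hA : A ⊆ G.neighborSet v)
    {y : {x : V // x ≠ v} ⊕ Bool → Bool}
    (hy : y ∈ evenLabelings (splitGraph G v A (G.neighborSet v \ A)))
    (hne : y (Sum.inr false) ≠ y (Sum.inr true)) :
    ∃ z : V → Bool, z v = false ∧ (∀ a b, a ≠ v → b ≠ v → G.Adj a b → z a = z b) ∧
      (∀ a, a ≠ v → Odd (deg G a) → z a = false) ∧
      ((∀ u, G.Adj v u → (z u = true ↔ u ∈ A)) ∨ (∀ u, G.Adj v u → (z u = true ↔ u ∉ A))) := by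
  classical
  have hAB : A ∪ (G.neighborSet v \ A) = G.neighborSet v := by
    rw [Set.union_sdiff_self, Set.union_eq_right]; exact hA
  have hd : A ∩ (G.neighborSet v \ A) = ∅ := Set.inter_sdiff_self _ _
  refine ⟨fun u => if hu : u = v then false else y (Sum.inl ⟨u, hu⟩), by simp, ?_, ?_, ?_⟩
  · intro a b ha hb hab
    simp only [ha, hb, dif_neg, not_false_eq_true]
    exact hy.1 (Sum.inl ⟨a, ha⟩) (Sum.inl ⟨b, hb⟩) hab
  · intro a ha hodd
    simp only [ha, dif_neg, not_false_eq_true]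
    refine hy.2 _ ?_
    rw [deg_splitGraph_inl hAB]
    simpa [hd] using hodd
  · have key : ∀ u (hu : u ≠ v), G.Adj v u →
        y (Sum.inl ⟨u, hu⟩) = if u ∈ A then y (Sum.inr false) else y (Sum.inr true) := by
      intro u hu hvu
      split_ifs with h
      · exact hy.1 (Sum.inl ⟨u, hu⟩) (Sum.inr false) h
      · exact hy.1 (Sum.inl ⟨u, hu⟩) (Sum.inr true) ⟨hvu, h⟩
    cases h1 : y (Sum.inr false) <;> cases h2 : y (Sum.inr true) <;> simp only [h1, h2] at key hne
    · simp at hne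
    · right
      intro u hvu
      simp [hvu.ne', key u hvu.ne' hvu]
    · left
      intro u hvu
      simp [hvu.ne', key u hvu.ne' hvu]
    · simp at hne

/-- If `{p, q}` and `{p, r}` were both bad, each would give a labeling off `v` separating the pair
from the other neighbors of `v`. Combined, they single out one neighbor, against the parity in
`even_ncard_neighbors_of_label`. -/
lemma exists_pair_split (h : 3 ≤ deg G v) : ∃ A ⊆ G.neighborSet v, A.ncard = 2 ∧
    ∀ y ∈ evenLabelings (splitGraph G v A (G.neighborSet v \ A)),
      y (Sum.inr false) = y (Sum.inr true) := by
  obtain ⟨p, q, r, hp, hq, hr, hpq, hpr, hqr⟩ := (Set.two_lt_ncard_iff (Set.toFinite _)).1 h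
  rw [SimpleGraph.mem_neighborSet] at hp hq hr
  by_contra! hcon
  have hA : ({p, q} : Set V) ⊆ G.neighborSet v := by
    rintro u (rfl | rfl) <;> assumption
  have hA' : ({p, r} : Set V) ⊆ G.neighborSet v := by
    rintro u (rfl | rfl) <;> assumption
  obtain ⟨y, hy, hne⟩ := hcon _ hA (Set.ncard_pair hpq)
  obtain ⟨y', hy', hne'⟩ := hcon _ hA' (Set.ncard_pair hpr)
  obtain ⟨z, hzv, hz, hodd, hzA⟩ := exists_label_of_ne hA hy hne
  obtain ⟨z', -, hz', -, hzA'⟩ := exists_label_of_ne hA' hy' hne'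
  have hmem : ∀ u, G.Adj v u → ((z' u == z' p) = true ↔ u = p ∨ u = r) := by
    intro u hu
    rcases hzA' with h' | h'
    · have h1 := h' u hu
      have h2 := h' p hp
      simp only [Set.mem_insert_iff, Set.mem_singleton_iff, true_or, iff_true] at h1 h2
      rw [h2, beq_true]; exact h1
    · have h1 := h' u hu
      have h2 := h' p hp
      simp only [Set.mem_insert_iff, Set.mem_singleton_iff, true_or, not_true, iff_false,
        Bool.not_eq_true] at h1 h2
      rw [h2, beq_false, Bool.not_eq_true', ← Bool.not_eq_true, h1, not_not]
  -- Comparison with `z' p` normalizes `z'` to mark exactly `{p, r}`. The product with `z` marks `p`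
  -- alone if `z` marks `{p, q}`, and `r` alone if `z` marks the complement.
  have hev := even_ncard_neighbors_of_label (G := G) (v := v) (z := fun u => z u && (z' u == z' p))
    (by simp [hzv]) (fun a b ha hb hab => by simp only [hz a b ha hb hab, hz' a b ha hb hab])
    (fun a ha ho => by simp [hodd a ha ho])
  have hone : ∃ t, {u | G.Adj v u ∧ (z u && (z' u == z' p)) = true} = {t} := by
    rcases hzA with hzA | hzA
    · refine ⟨p, ?_⟩
      ext u
      simp only [Set.mem_ofPred_eq, Set.mem_singleton_iff, Bool.and_eq_true]
      constructor
      · rintro ⟨h1, h2, h3⟩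
        rw [hmem u h1] at h3
        rw [hzA u h1] at h2
        rcases h2 with h2 | h2
        · exact h2
        · rcases h3 with h3 | h3
          · exact h3
          · exact absurd (h2.symm.trans h3) hqr
      · rintro rfl
        exact ⟨hp, (hzA u hp).2 (Or.inl rfl), (hmem u hp).2 (Or.inl rfl)⟩
    · refine ⟨r, ?_⟩
      ext u
      simp only [Set.mem_ofPred_eq, Set.mem_singleton_iff, Bool.and_eq_true]
      constructor
      · rintro ⟨h1, h2, h3⟩
        rw [hmem u h1] at h3
        rw [hzA u h1] at h2
        rcases h3 with h3 | h3
        · exact absurd (Or.inl h3) h2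
        · exact h3
      · rintro rfl
        refine ⟨hr, (hzA u hr).2 ?_, (hmem u hr).2 (Or.inr rfl)⟩
        rintro (h1 | h1)
        · exact hpr h1.symm
        · exact hqr h1.symm
  obtain ⟨t, ht⟩ := hone
  rw [ht, Set.ncard_singleton] at hev
  exact Nat.not_even_one hev

/-- Detaching two edges leaves the sum of half degrees unchanged, and all labelings descend. -/
lemma splitRank_split_pair_le {A : Set V} (hA : A ⊆ G.neighborSet v) (hA2 : A.ncard = 2)
    (hf : ∀ y ∈ evenLabelings (splitGraph G v A (G.neighborSet v \ A)),
      y (Sum.inr false) = y (Sum.inr true)) :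
    splitRank (splitGraph G v A (G.neighborSet v \ A)) ≤ splitRank G := by
  classical
  have hAB : A ∪ (G.neighborSet v \ A) = G.neighborSet v := by
    rw [Set.union_sdiff_self, Set.union_eq_right]; exact hA
  have hd : A ∩ (G.neighborSet v \ A) = ∅ := Set.inter_sdiff_self _ _
  have hsum := finsum_splitGraph_of_disjoint hAB hd
  have hdeg := deg_eq_add_of_disjoint hAB hd
  rw [hA2] at hsum hdeg
  have h1 : (evenLabelings (splitGraph G v A (G.neighborSet v \ A))).ncard ≤
      (evenLabelings G).ncard :=
    Set.ncard_le_ncard_of_injOn _ (fun y hy => unlift_mem_evenLabelings hAB hd hy (hf y hy))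
      ((unlift_injOn v).mono fun y hy => hf y hy) (Set.toFinite _)
  have h2 := Nat.log_mono_right (b := 2) h1
  rw [splitRank, splitRank]
  omega

lemma exists_split_of_not_splitIrreducible (h : ¬ SplitIrreducible G) :
    ∃ (v : V) (A B : Set V), A ∪ B = G.neighborSet v ∧ A ∩ B = ∅ ∧
      splitRank (splitGraph G v A B) ≤ splitRank G := by
  have key : ∃ (v : V) (A : Set V), A ⊆ G.neighborSet v ∧
      splitRank (splitGraph G v A (G.neighborSet v \ A)) ≤ splitRank G := by
    by_cases h2 : ∀ v, deg G v ≤ 2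
    · have : ∃ x ∈ evenLabelings G, ∃ v, x v = true ∧ deg G v ≠ 0 := by
        by_contra! hc
        exact h ⟨h2, hc⟩
      obtain ⟨x, hx, v, hxv, hv⟩ := this
      obtain ⟨p, hp⟩ := Set.nonempty_of_ncard_ne_zero hv
      exact ⟨v, {p}, Set.singleton_subset_iff.2 hp, splitRank_split_neighbor_le hx hxv hp⟩
    · push Not at h2
      obtain ⟨v, hv⟩ := h2
      obtain ⟨A, hA, hA2, hf⟩ := exists_pair_split hv
      exact ⟨v, A, hA, splitRank_split_pair_le hA hA2 hf⟩
  obtain ⟨v, A, hA, hle⟩ := key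
  exact ⟨v, A, _, by rw [Set.union_sdiff_self, Set.union_eq_right]; exact hA,
    Set.inter_sdiff_self _ _, hle⟩

end Reduce

/-! ### The minimum number of splits -/

lemma ExclusiveSplitSeq.splitSeq {V W : Type u} {G : SimpleGraph V} {H : SimpleGraph W} {k : ℕ}
    (h : ExclusiveSplitSeq G k H) : SplitSeq G k H := by
  induction h with
  | nil G => exact .nil G
  | cons v A B hAB _ _ ih => exact .cons v A B hAB ih

lemma SplitSeq.splitRank_le {V W : Type u} {G : SimpleGraph V} {H : SimpleGraph W} {k : ℕ}
    (h : SplitSeq G k H) (hfin : Finite V) (hG : G.CliqueFree 3) (hH : IsUnitInterval H) :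
    splitRank G ≤ Nat.card V + k := by
  induction h with
  | nil G => exact splitRank_le_card_of_isUnitInterval hG hH
  | cons v A B hAB _ ih =>
    have h1 := ih inferInstance (cliqueFree_splitGraph hG hAB) hH
    have h2 := splitRank_le_splitGraph hAB
    rw [card_splitGraph] at h1
    omega

/-- A split at constant rank lowers `k` by one, and `card_le_splitRank` for the split graph gives `k
> 0`. The second alternative covers irreducible graphs with `k > 0`; for triangle-free graphs the
lower bound excludes it later. -/
lemma exists_exclusiveSplitSeq (k : ℕ) {V : Type u} [Finite V] (G : SimpleGraph V)
    (hk : splitRank G = Nat.card V + k) :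
    k ∈ unitIntervalExclusiveSplitLengths G ∨
      ∃ j < k, j ∈ unitIntervalExclusiveSplitLengths G := by
  induction k using Nat.strong_induction_on generalizing V with
  | _ k ih =>
  by_cases hG : SplitIrreducible G
  · have h0 : (0 : ℕ) ∈ unitIntervalExclusiveSplitLengths G :=
      ⟨V, G, .nil G, hG.isUnitInterval⟩
    rcases Nat.eq_zero_or_pos k with rfl | hpos
    · exact Or.inl h0
    · exact Or.inr ⟨0, hpos, h0⟩
  · obtain ⟨v, A, B, hAB, hd, hle⟩ := exists_split_of_not_splitIrreducible hG
    have h1 := card_le_splitRank (splitGraph G v A B)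
    have h2 := card_splitGraph v
    have h3 := splitRank_le_splitGraph hAB
    have hk' : splitRank (splitGraph G v A B) =
        Nat.card ({x : V // x ≠ v} ⊕ Bool) + (k - 1) := by omega
    rcases ih (k - 1) (by omega) (splitGraph G v A B) hk' with ⟨W, H, hs, hH⟩ | ⟨j, hj, W, H, hs, hH⟩
    · refine Or.inl ⟨W, H, ?_, hH⟩
      have := ExclusiveSplitSeq.cons v A B hAB hd hs
      rwa [show k - 1 + 1 = k by omega] at this
    · exact Or.inr ⟨j + 1, by omega, W, H, .cons v A B hAB hd hs, hH⟩

theorem isLeast_unitIntervalSplitLengths {V : Type u} [Finite V] {G : SimpleGraph V}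
    (hG : G.CliqueFree 3) :
    IsLeast (unitIntervalSplitLengths G) (splitRank G - Nat.card V) ∧
      IsLeast (unitIntervalExclusiveSplitLengths G) (splitRank G - Nat.card V) := by
  have hcard := card_le_splitRank G
  have hlow : ∀ k ∈ unitIntervalSplitLengths G, splitRank G - Nat.card V ≤ k := by
    rintro k ⟨W, H, hs, hH⟩
    have := hs.splitRank_le inferInstance hG hH
    omega
  have hsub : unitIntervalExclusiveSplitLengths G ⊆ unitIntervalSplitLengths G := by
    rintro k ⟨W, H, hs, hH⟩
    exact ⟨W, H, hs.splitSeq, hH⟩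
  have hmem : splitRank G - Nat.card V ∈ unitIntervalExclusiveSplitLengths G := by
    rcases exists_exclusiveSplitSeq (splitRank G - Nat.card V) G (by omega) with h | ⟨j, hj, h⟩
    · exact h
    · exact absurd (hlow j (hsub h)) (by omega)
  exact ⟨⟨hsub hmem, hlow⟩, hmem, fun k hk => hlow k (hsub hk)⟩

theorem UIVS_eq {V : Type u} [Finite V] {G : SimpleGraph V} (hG : G.CliqueFree 3) :
    UIVS G = splitRank G - Nat.card V :=
  (isLeast_unitIntervalSplitLengths hG).1.csInf_eq

theorem UIVXS_eq {V : Type u} [Finite V] {G : SimpleGraph V} (hG : G.CliqueFree 3) :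
    UIVXS G = splitRank G - Nat.card V :=
  (isLeast_unitIntervalSplitLengths hG).2.csInf_eq

end VertexSplitting

namespace VertexSplitting

/-! ### The machine -/

/-- The stacks of the machine: input and current matrix, current row, two auxiliary store, a unary
counter, and the output. -/
inductive Stack | I | L | R | Y | U | O
  deriving DecidableEq

instance : Fintype Stack :=
  ⟨{.I, .L, .R, .Y, .U, .O}, fun k => by cases k <;> decide⟩

/-- The labels of the machine. -/
inductive Label
  | readSize | degNext | degRow (p : Bool) | degRestore | back | eliminate | readRow
  | testRow (z : Bool) | rows | rowOp (b : Bool) | rowRestore | toBinary | inc | carryBack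
  deriving DecidableEq, Fintype

open Stack Label

/-- The statements of the machine. -/
abbrev Code : Type := Turing.TM2.Stmt (fun _ : Stack => Bool) Label (Option Bool × Option Bool)

/-- Clear the registers and jump. -/
def Code.go (l : Label) : Code := .load (fun _ => (none, none)) (.goto fun _ => l)

/-- Pop a stack into the first register. -/
def Code.popFst (k : Stack) (q : Code) : Code := .pop k (fun s o => (o, s.2)) q

/-- Pop a stack into the second register. -/
def Code.popSnd (k : Stack) (q : Code) : Code := .pop k (fun s o => (s.1, o)) q

/-- Push the first register. -/
def Code.pushFst (k : Stack) (q : Code) : Code := .push k (fun s => s.1.getD false) q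

/-- Push a constant. -/
def Code.pushBit (k : Stack) (b : Bool) (q : Code) : Code := .push k (fun _ => b) q

/-- Branch on whether the first register is empty. -/
def Code.ifEmpty (q q' : Code) : Code := .branch (fun s => s.1.isNone) q q'

/-- Branch on whether the first register holds `true`. -/
def Code.ifTrue (q q' : Code) : Code := .branch (fun s => s.1.getD false) q q'

open Code in
/-- The program. It counts half degrees in unary on `U` while it appends to every row of the
adjacency matrix the parity of the degree; then it eliminates the rows one by one, decrementing the
counter at every nonzero row; then it converts the counter to binary. -/
def program : Label → Code
  | readSize => popFst I (ifTrue (pushBit L true (go readSize)) (go degNext))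
  | degNext => .peek I (fun s o => (o, s.2))
      (ifEmpty (pushBit L true (go back)) (go (degRow false)))
  -- `U` grows at the first, third, … one of a row, hence by ⌈deg/2⌉.
  | degRow p => popFst L (ifEmpty (pushBit Y p (go degRestore))
      (pushBit R true (popFst I (pushFst Y (ifTrue
        (bif p then go (degRow false) else pushBit U true (go (degRow true)))
        (go (degRow p)))))))
  | degRestore => popFst R (ifEmpty (go degNext) (pushFst L (go degRestore)))
  | back => popFst Y (ifEmpty (go eliminate) (pushFst I (go back)))
  -- The length of `L` is the current row width; one symbol goes, together with the irrelevant
  -- diagonal entry.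
  | eliminate => popFst L (popFst I (ifEmpty (go toBinary) (go readRow)))
  -- `L` is used up as a counter and then refilled by `testRow` with the pivot row, which also
  -- serves as the next counter.
  | readRow => popFst L (ifEmpty (go (testRow false)) (popFst I (pushFst R (go readRow))))
  | testRow z => popFst R (ifEmpty (bif z then popFst U (go rows) else go rows)
      (pushFst L (ifTrue (go (testRow true)) (go (testRow z)))))
  | rows => popFst I (ifEmpty (go back) (ifTrue (go (rowOp true)) (go (rowOp false))))
  | rowOp b => popFst L (ifEmpty (go rowRestore) (pushFst R (popSnd I
      (.push Y (fun s => s.2.getD false || (b && s.1.getD false)) (go (rowOp b))))))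
  | rowRestore => popFst R (ifEmpty (go rows) (pushFst L (go rowRestore)))
  | toBinary => popFst U (ifEmpty (.load (fun _ => (none, none)) .halt) (go inc))
  -- An empty `O` reads as a zero bit and ends the carry.
  | inc => popFst O (ifTrue (pushBit R false (go inc)) (pushBit O true (go carryBack)))
  | carryBack => popFst R (ifEmpty (go toBinary) (pushFst O (go carryBack)))

/-- The machine. -/
def machine : Turing.FinTM2 where
  K := Stack
  k₀ := I
  k₁ := O
  Γ _ := Bool
  Λ := Label
  main := readSize
  σ := Option Bool × Option Bool
  initialState := (none, none)
  m := program

/-- Configurations. -/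
abbrev Config : Type :=
  Turing.TM2.Cfg (fun _ : Stack => Bool) Label (Option Bool × Option Bool)

/-! ### Configurations and runs -/

/-- The contents of the stacks. -/
def store (i l r y u o : List Bool) : Stack → List Bool
  | I => i
  | L => l
  | R => r
  | Y => y
  | U => u
  | O => o

section StackLemmas
variable (i l r y u o w : List Bool)

@[simp] lemma store_I : store i l r y u o I = i := rfl
@[simp] lemma store_L : store i l r y u o L = l := rfl
@[simp] lemma store_R : store i l r y u o R = r := rfl
@[simp] lemma store_Y : store i l r y u o Y = y := rfl
@[simp] lemma store_U : store i l r y u o U = u := rfl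
@[simp] lemma store_O : store i l r y u o O = o := rfl
@[simp] lemma update_store_I :
    Function.update (store i l r y u o) I w = store w l r y u o := by
  funext k; cases k <;> rfl
@[simp] lemma update_store_L :
    Function.update (store i l r y u o) L w = store i w r y u o := by
  funext k; cases k <;> rfl
@[simp] lemma update_store_R :
    Function.update (store i l r y u o) R w = store i l w y u o := by
  funext k; cases k <;> rfl
@[simp] lemma update_store_Y :
    Function.update (store i l r y u o) Y w = store i l r w u o := by
  funext k; cases k <;> rfl
@[simp] lemma update_store_U :
    Function.update (store i l r y u o) U w = store i l r y w o := by
  funext k; cases k <;> rfl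
@[simp] lemma update_store_O :
    Function.update (store i l r y u o) O w = store i l r y u w := by
  funext k; cases k <;> rfl

end StackLemmas

/-- The configuration at a label, with empty registers. -/
def at_ (a : Label) (i l r y u o : List Bool) : Config :=
  ⟨some a, (none, none), store i l r y u o⟩

/-- `Run t c c'`: the machine goes from `c` to `c'` in `t` steps. -/
def Run (t : ℕ) (c c' : Config) : Prop :=
  (flip bind (Turing.TM2.step program))^[t] (some c) = some c'

lemma Run.refl (c : Config) : Run 0 c c := rfl

lemma Run.trans {s t : ℕ} {c c' c'' : Config} (h : Run s c c') (h' : Run t c' c'') :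
    Run (s + t) c c'' := by
  unfold Run at *
  rw [add_comm, Function.iterate_add_apply, h, h']

lemma Run.head {t : ℕ} {c c' c'' : Config} (h : Turing.TM2.step program c = some c')
    (h' : Run t c' c'') : Run (t + 1) c c'' := by
  unfold Run at *
  rw [Function.iterate_succ_apply, ← h']
  congr 1

lemma Run.single {c c' : Config} (h : Turing.TM2.step program c = some c') : Run 1 c c' :=
  Run.head h (Run.refl _)

lemma Run.of_eq {s t : ℕ} {c c' c'' : Config} (h : Run s c c') (hs : s = t) (hc : c' = c'') :
    Run t c c'' := hs ▸ hc ▸ h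


attribute [local simp] at_ Turing.TM2.step Turing.TM2.stepAux program Code.go Code.popFst
  Code.popSnd Code.pushFst Code.pushBit Code.ifEmpty Code.ifTrue

/-! ### The loops of the program and their running times -/

section Loops
variable {i l r y u o : List Bool}

lemma run_readSize (n m : ℕ) :
    Run (n + 1) (at_ readSize (List.replicate n true ++ false :: i) (List.replicate m true) r y u o)
      (at_ degNext i (List.replicate (m + n) true) r y u o) := by
  induction n generalizing m with
  | zero => exact Run.single (by simp)
  | succ n ih =>
    refine Run.head (c' := at_ readSize (List.replicate n true ++ false :: i)
      (List.replicate (m + 1) true) r y u o) (by simp [List.replicate_succ]) ?_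
    exact (ih (m + 1)).of_eq rfl (by congr 2; omega)

/-- The number of counter increments in a row with `c` ones, started with parity `p`. -/
def halfCount (p : Bool) (c : ℕ) : ℕ := bif p then c / 2 else (c + 1) / 2

lemma run_degRow (w : List Bool) (p : Bool) (m k : ℕ) :
    Run (w.length + 1)
      (at_ (degRow p) (w ++ i) (List.replicate w.length true) (List.replicate m true) y
        (List.replicate k true) o)
      (at_ degRestore i [] (List.replicate (m + w.length) true)
        (xor p (decide (Odd (w.count true))) :: (w.reverse ++ y))
        (List.replicate (k + halfCount p (w.count true)) true) o) := by
  induction w generalizing p m k y with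
  | nil => exact Run.single (by cases p <;> simp [halfCount])
  | cons b w ih =>
    cases b
    · refine Run.head (c' := at_ (degRow p) (w ++ i) (List.replicate w.length true)
        (List.replicate (m + 1) true) (false :: y) (List.replicate k true) o)
        (by simp [List.replicate_succ]) ?_
      refine (ih p (m + 1) k).of_eq (by simp) ?_
      simp
      congr 2
      omega
    · cases p
      · refine Run.head (c' := at_ (degRow true) (w ++ i) (List.replicate w.length true)
          (List.replicate (m + 1) true) (true :: y) (List.replicate (k + 1) true) o)
          (by simp [List.replicate_succ]) ?_
        refine (ih true (m + 1) (k + 1)).of_eq (by simp) ?_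
        simp only [halfCount, List.count_cons_self, List.length_cons, List.reverse_cons,
          List.append_assoc, List.singleton_append, cond_true, cond_false, Nat.odd_add_one,
          decide_not, Bool.true_xor, Bool.false_xor]
        congr 2 <;> omega
      · refine Run.head (c' := at_ (degRow false) (w ++ i) (List.replicate w.length true)
          (List.replicate (m + 1) true) (true :: y) (List.replicate k true) o)
          (by simp [List.replicate_succ]) ?_
        refine (ih false (m + 1) k).of_eq (by simp) ?_
        simp only [halfCount, List.count_cons_self, List.length_cons, List.reverse_cons,
          List.append_assoc, List.singleton_append, cond_true, cond_false, Nat.odd_add_one,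
          decide_not, Bool.true_xor, Bool.false_xor, Bool.not_not]
        congr 2; omega

lemma run_degRestore (m k : ℕ) :
    Run (k + 1)
      (at_ degRestore i (List.replicate m true) (List.replicate k true) y u o)
      (at_ degNext i (List.replicate (m + k) true) [] y u o) := by
  induction k generalizing m with
  | zero => exact Run.single (by simp)
  | succ k ih =>
    refine Run.head (c' := at_ degRestore i (List.replicate (m + 1) true)
      (List.replicate k true) y u o) (by simp [List.replicate_succ]) ?_
    exact (ih (m + 1)).of_eq rfl (by congr 2; omega)

/-- The next row is detected by peeking at `I`, so rows must not be empty; this is `hn`. -/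
lemma run_degNext (n : ℕ) (ws : List (List Bool)) (hws : ∀ w ∈ ws, w.length = n) (hn : ws ≠ [] → n ≠ 0)
    (k : ℕ) :
    Run (ws.length * (2 * n + 3) + 1)
      (at_ degNext ws.flatten (List.replicate n true) [] y (List.replicate k true) o)
      (at_ back [] (List.replicate (n + 1) true) []
        ((ws.map fun w => w ++ [decide (Odd (w.count true))]).flatten.reverse ++ y)
        (List.replicate (k + (ws.map fun w => (w.count true + 1) / 2).sum) true) o) := by
  induction ws generalizing k y with
  | nil =>
    rw [List.length_nil, Nat.zero_mul, Nat.zero_add]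
    exact Run.single (by simp [List.replicate_succ])
  | cons w ws ih =>
    have hw : w.length = n := hws w (by simp)
    have hn0 := hn (by simp)
    obtain ⟨b, w', rfl⟩ := List.exists_cons_of_length_pos (l := w) (by omega)
    have h1 : Turing.TM2.step program
        (at_ degNext ((b :: w') :: ws).flatten (List.replicate n true) [] y
          (List.replicate k true) o) =
        some (at_ (degRow false) ((b :: w') ++ ws.flatten) (List.replicate (b :: w').length true)
          (List.replicate 0 true) y (List.replicate k true) o) := by
      rw [hw]; simp
    have h2 := Run.head h1 (run_degRow (b :: w') false 0 k)
    have h3 := h2.trans (run_degRestore 0 _)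
    rw [zero_add, zero_add, hw] at h3
    have h4 := h3.trans (ih (fun w hw => hws w (by simp [hw])) (fun _ => hn0) _)
    refine h4.of_eq ?_ ?_
    · simp only [List.length_cons]; ring
    · simp only [halfCount, cond_false, List.map_cons, List.sum_cons, List.flatten_cons,
        Bool.false_xor, List.reverse_append, List.reverse_cons, List.append_assoc,
        List.nil_append, List.cons_append, add_assoc]

lemma run_back : Run (y.length + 1) (at_ back i l r y u o)
    (at_ eliminate (y.reverse ++ i) l r [] u o) := by
  induction y generalizing i with
  | nil => exact Run.single (by simp)
  | cons b y ih =>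
    exact (Run.head (c' := at_ back (b :: i) l r y u o) (by simp) ih).of_eq (by simp) (by simp)

lemma run_readRow (w : List Bool) (hw : w.length = l.length) :
    Run (w.length + 1) (at_ readRow (w ++ i) l r y u o)
      (at_ (testRow false) i [] (w.reverse ++ r) y u o) := by
  induction w generalizing l r with
  | nil =>
    obtain rfl := List.eq_nil_of_length_eq_zero hw.symm
    exact Run.single (by simp)
  | cons b w ih =>
    obtain ⟨a, l, rfl⟩ := List.exists_cons_of_length_pos (l := l) (by simp [← hw])
    exact (Run.head (c' := at_ readRow (w ++ i) l (b :: r) y u o) (by simp)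
      (ih (by simpa using hw))).of_eq (by simp) (by simp)

lemma run_testRow (z : Bool) : Run (r.length + 1) (at_ (testRow z) i l r y u o)
    (at_ rows i (r.reverse ++ l) [] y (bif z || r.any id then u.tail else u) o) := by
  induction r generalizing l z with
  | nil => exact Run.single (by cases z <;> cases u <;> simp)
  | cons b r ih =>
    exact (Run.head (c' := at_ (testRow (z || b)) i (b :: l) r y u o)
      (by cases z <;> cases b <;> simp) (ih (z || b))).of_eq (by simp) (by simp [Bool.or_assoc])

lemma run_rowOp (b : Bool) (w : List Bool) (hw : w.length = l.length) :
    Run (w.length + 1) (at_ (rowOp b) (w ++ i) l r y u o)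
      (at_ rowRestore i [] (l.reverse ++ r)
        ((List.zipWith (fun p q => p || (b && q)) w l).reverse ++ y) u o) := by
  induction w generalizing l r y with
  | nil =>
    obtain rfl := List.eq_nil_of_length_eq_zero hw.symm
    exact Run.single (by simp)
  | cons p w ih =>
    obtain ⟨a, l, rfl⟩ := List.exists_cons_of_length_pos (l := l) (by simp [← hw])
    exact (Run.head (c' := at_ (rowOp b) (w ++ i) l (a :: r) ((p || (b && a)) :: y) u o) (by simp)
      (ih (by simpa using hw))).of_eq (by simp) (by simp)

lemma run_rowRestore : Run (r.length + 1) (at_ rowRestore i l r y u o)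
    (at_ rows i (r.reverse ++ l) [] y u o) := by
  induction r generalizing l with
  | nil => exact Run.single (by simp)
  | cons b r ih =>
    exact (Run.head (c' := at_ rowRestore i (b :: l) r y u o) (by simp) ih).of_eq
      (by simp) (by simp)

lemma run_rows (ws : List (Bool × List Bool)) (hws : ∀ w ∈ ws, w.2.length = l.length) :
    Run (ws.length * (2 * l.length + 3) + 1)
      (at_ rows (ws.map fun w => w.1 :: w.2).flatten l [] y u o)
      (at_ back [] l [] ((ws.map fun w =>
        List.zipWith (fun p q => p || (w.1 && q)) w.2 l).flatten.reverse ++ y) u o) := by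
  induction ws generalizing y with
  | nil =>
    rw [List.length_nil, Nat.zero_mul, Nat.zero_add]
    exact Run.single (by simp)
  | cons w ws ih =>
    obtain ⟨b, w⟩ := w
    have hw : w.length = l.length := hws (b, w) (by simp)
    have h1 : Turing.TM2.step program
        (at_ rows (((b, w) :: ws).map fun w => w.1 :: w.2).flatten l [] y u o) =
        some (at_ (rowOp b) (w ++ (ws.map fun w => w.1 :: w.2).flatten) l [] y u o) := by
      cases b <;> simp
    have h2 := (Run.head h1 (run_rowOp b w hw)).trans run_rowRestore
    simp only [List.append_nil, List.reverse_reverse] at h2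
    refine (h2.trans (ih fun w hw => hws w (by simp [hw]))).of_eq ?_ ?_
    · simp only [List.length_cons, List.length_reverse, hw]; ring
    · simp

lemma run_eliminate_row (a b : Bool) (w : List Bool) (hl : l.length = w.length)
    (ws : List (Bool × List Bool)) (hws : ∀ v ∈ ws, v.2.length = w.length) :
    Run (ws.length * (3 * w.length + 3) + 2 * w.length + 5)
      (at_ eliminate (b :: w ++ (ws.map fun v => v.1 :: v.2).flatten) (a :: l) [] [] u o)
      (at_ eliminate (ws.map fun v =>
        List.zipWith (fun p q => p || (v.1 && q)) v.2 w).flatten w [] []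
        (bif w.any id then u.tail else u) o) := by
  have h1 : Turing.TM2.step program
      (at_ eliminate (b :: w ++ (ws.map fun v => v.1 :: v.2).flatten) (a :: l) [] [] u o) =
      some (at_ readRow (w ++ (ws.map fun v => v.1 :: v.2).flatten) l [] [] u o) := by
    simp
  have h2 := (Run.head h1 (run_readRow w hl.symm)).trans (run_testRow false)
  simp only [List.append_nil, List.reverse_reverse, List.any_reverse, Bool.false_or] at h2
  refine ((h2.trans (run_rows ws hws)).trans run_back).of_eq ?_ ?_
  · have : ∀ ws : List (Bool × List Bool), (∀ v ∈ ws, v.2.length = w.length) →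
        (ws.map fun v => List.zipWith (fun p q => p || (v.1 && q)) v.2 w).flatten.length =
          ws.length * w.length := by
      intro ws hws
      induction ws with
      | nil => simp
      | cons v ws ih =>
        rw [List.map_cons, List.flatten_cons, List.length_append,
          ih fun v hv => hws v (by simp [hv])]
        simp [hws v (by simp)]
        ring
    simp only [List.append_nil, List.length_reverse, this ws hws]
    ring
  · simp

/-! ### Conversion of the unary counter to binary -/

/-- Binary increment. -/
def incBits : List Bool → List Bool
  | [] => [true]
  | false :: o => true :: o
  | true :: o => false :: incBits o

lemma length_incBits_le (o : List Bool) : (incBits o).length ≤ o.length + 1 := by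
  induction o with
  | nil => simp [incBits]
  | cons b o ih => cases b <;> simp [incBits, ih]

lemma replicate_false_append_cons (n : ℕ) (o : List Bool) :
    List.replicate n false ++ false :: o = false :: (List.replicate n false ++ o) := by
  induction n with
  | zero => simp
  | succ n ih => simp [List.replicate_succ, ih]

lemma run_carryBack (m : ℕ) : Run (m + 1) (at_ carryBack i l (List.replicate m false) y u o)
    (at_ toBinary i l [] y u (List.replicate m false ++ o)) := by
  induction m generalizing o with
  | zero => exact Run.single (by simp)
  | succ m ih =>
    exact (Run.head (c' := at_ carryBack i l (List.replicate m false) y u (false :: o))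
      (by simp [List.replicate_succ]) ih).of_eq (by simp)
      (by rw [replicate_false_append_cons]; simp [List.replicate_succ])

lemma run_inc (m : ℕ) : ∃ t ≤ 2 * o.length + m + 2,
    Run t (at_ inc i l (List.replicate m false) y u o)
      (at_ toBinary i l [] y u (List.replicate m false ++ incBits o)) := by
  induction o generalizing m with
  | nil =>
    exact ⟨m + 1 + 1, by simp, Run.head (c' := at_ carryBack i l (List.replicate m false) y u [true])
      (by simp) (run_carryBack m)⟩
  | cons b o ih =>
    cases b
    · exact ⟨m + 1 + 1, by simp, Run.head
        (c' := at_ carryBack i l (List.replicate m false) y u (true :: o)) (by simp)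
        (run_carryBack m)⟩
    · obtain ⟨t, ht, h⟩ := ih (m + 1)
      refine ⟨t + 1, by simp; omega, Run.head (c' := at_ inc i l (List.replicate (m + 1) false) y u o)
        (by simp [List.replicate_succ]) (h.of_eq rfl ?_)⟩
      rw [incBits, replicate_false_append_cons]
      simp [List.replicate_succ]

lemma encodePosNum_succ (p : PosNum) :
    Computability.encodePosNum p.succ = incBits (Computability.encodePosNum p) := by
  induction p with
  | one => rfl
  | bit0 p ih => rfl
  | bit1 p ih => simp only [PosNum.succ, Computability.encodePosNum, incBits, ih]

lemma encodeNat_succ (k : ℕ) :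
    Computability.encodeNat (k + 1) = incBits (Computability.encodeNat k) := by
  have h : ((k + 1 : ℕ) : Num) = Num.succ k := by
    rw [Nat.cast_add_one, Num.add_one]
  rw [Computability.encodeNat, Computability.encodeNat, h]
  cases (k : Num) with
  | zero => rfl
  | pos p => exact encodePosNum_succ p

/-- A crude bound suffices, because the counter is unary. -/
lemma length_encodeNat_le (k : ℕ) : (Computability.encodeNat k).length ≤ k := by
  induction k with
  | zero => simp [Computability.encodeNat, Computability.encodeNum]
  | succ k ih => rw [encodeNat_succ]; exact (length_incBits_le _).trans (by omega)

lemma run_toBinary (k m : ℕ) : ∃ t ≤ m * (2 * (k + m) + 3) + 1,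
    Run t (at_ toBinary i l [] y (List.replicate m true) (Computability.encodeNat k))
      ⟨none, (none, none), store i l [] y [] (Computability.encodeNat (k + m))⟩ := by
  induction m generalizing k with
  | zero => exact ⟨1, by omega, Run.single (by simp)⟩
  | succ m ih =>
    obtain ⟨t, ht, h⟩ := run_inc (i := i) (l := l) (y := y) (u := List.replicate m true)
      (o := Computability.encodeNat k) 0
    obtain ⟨t', ht', h'⟩ := ih (k + 1)
    rw [List.replicate_zero, List.nil_append, ← encodeNat_succ] at h
    refine ⟨t + t' + 1, ?_, Run.head (by simp [List.replicate_succ]) ((h.trans h').of_eq rfl ?_)⟩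
    · have := length_encodeNat_le k
      rw [show k + 1 + m = k + (m + 1) by ring] at ht'
      nlinarith
    · rw [show k + 1 + m = k + (m + 1) by ring]

end Loops

end VertexSplitting

namespace VertexSplitting

open Stack Label

/-! ### Elimination of vertices -/

/-- Eliminate vertex `0`: its neighbors become pairwise adjacent. The last column of a matrix
stands for an additional vertex. -/
def eliminateFirst {m : ℕ} (M : Fin (m + 1) → Fin (m + 2) → Bool) (i : Fin m) (j : Fin (m + 1)) :
    Bool :=
  M i.succ j.succ || (M i.succ 0 && M 0 j.succ)

/-- The number of vertices that are not isolated at the time of their elimination. -/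
def pivots : (m : ℕ) → (Fin m → Fin (m + 1) → Bool) → ℕ
  | 0, _ => 0
  | m + 1, M => (if ∃ j : Fin (m + 1), M 0 j.succ = true then 1 else 0) +
      pivots m (eliminateFirst M)

/-- The labelings that are constant along the adjacencies and vanish at the last vertex. -/
def solutions {m : ℕ} (M : Fin m → Fin (m + 1) → Bool) : Set (Fin (m + 1) → Bool) :=
  {x | x (Fin.last m) = false ∧ ∀ i j, M i j = true → x i.castSucc = x j}

lemma tail_mem_solutions {m : ℕ} {M : Fin (m + 1) → Fin (m + 2) → Bool} {x : Fin (m + 2) → Bool}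
    (hx : x ∈ solutions M) : Fin.tail x ∈ solutions (eliminateFirst M) := by
  refine ⟨hx.1, fun i j h => ?_⟩
  rw [eliminateFirst, Bool.or_eq_true, Bool.and_eq_true] at h
  rcases h with h | ⟨h1, h2⟩
  · exact hx.2 _ _ h
  · exact (hx.2 _ _ h1).trans (hx.2 0 _ h2)

/-- If vertex `0` has a neighbor, its label is determined, and joining its neighbors pairwise
preserves the constraint it imposed on them. Otherwise its label is free and doubles the count. The
last vertex has no row and is never eliminated. -/
lemma ncard_solutions {m : ℕ} (M : Fin m → Fin (m + 1) → Bool)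
    (hM : ∀ i j : Fin m, M i j.castSucc = M j i.castSucc) :
    pivots m M ≤ m ∧ (solutions M).ncard = 2 ^ (m - pivots m M) := by
  induction m with
  | zero =>
    have : solutions M = {fun _ => false} := by
      ext x
      simp only [solutions, Set.mem_ofPred_eq, Set.mem_singleton_iff, IsEmpty.forall_iff, and_true]
      constructor
      · intro h; funext k; rwa [show k = Fin.last 0 from Fin.ext (by omega)]
      · rintro rfl; rfl
    simp [pivots, this]
  | succ m ih =>
    have hsym : ∀ i : Fin m, M i.succ 0 = M 0 i.castSucc.succ := fun i => hM i.succ 0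
    obtain ⟨h1, h2⟩ := ih (eliminateFirst M) fun i j => by
      have := hM i.succ j.succ
      rw [← Fin.succ_castSucc, ← Fin.succ_castSucc] at this
      rw [eliminateFirst, eliminateFirst, this, hsym, hsym, Bool.and_comm]
    have hsucc : ∀ (b : Bool) (y : Fin (m + 1) → Bool), y ∈ solutions (eliminateFirst M) →
        (∀ j : Fin (m + 1), M 0 j.succ = true → b = y j) →
        (Fin.cons b y : Fin (m + 2) → Bool) ∈ solutions M := by
      intro b y hy hb
      refine ⟨hy.1, fun i j h => ?_⟩
      cases i using Fin.cases with
      | zero =>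
        cases j using Fin.cases with
        | zero => rfl
        | succ j => exact hb j h
      | succ i =>
        cases j using Fin.cases with
        | zero =>
          rw [hsym] at h
          exact (hb _ h).symm
        | succ j =>
          exact hy.2 i j (by rw [eliminateFirst, h, Bool.true_or])
    by_cases hp : ∃ j : Fin (m + 1), M 0 j.succ = true
    · rw [pivots, if_pos hp]
      obtain ⟨j₀, hj₀⟩ := hp
      -- As the last vertex has no row, a pair containing it is read off the row of the other
      -- vertex.
      have hclaim : ∀ y ∈ solutions (eliminateFirst M), ∀ j j' : Fin (m + 1),
          M 0 j.succ = true → M 0 j'.succ = true → y j = y j' := by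
        intro y hy j j' hj hj'
        have aux : ∀ (i : Fin m) (j' : Fin (m + 1)), M 0 i.castSucc.succ = true →
            M 0 j'.succ = true → y i.castSucc = y j' := fun i j' hi hj' =>
          hy.2 i j' (by rw [eliminateFirst, hsym, hi, hj']; simp)
        cases j using Fin.lastCases with
        | cast i => exact aux i j' hj hj'
        | last =>
          cases j' using Fin.lastCases with
          | cast i => exact (aux i _ hj' hj).symm
          | last => rfl
      have hS : solutions M =
          (fun y : Fin (m + 1) → Bool => (Fin.cons (y j₀) y : Fin (m + 2) → Bool)) ''
            solutions (eliminateFirst M) := by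
        ext x
        constructor
        · intro hx
          refine ⟨Fin.tail x, tail_mem_solutions hx, ?_⟩
          have : Fin.tail x j₀ = x 0 := (hx.2 0 _ hj₀).symm
          dsimp only
          rw [this, Fin.cons_self_tail]
        · rintro ⟨y, hy, rfl⟩
          exact hsucc _ y hy fun j hj => hclaim y hy _ _ hj₀ hj
      rw [hS, Set.ncard_image_of_injective, h2]
      · refine ⟨by omega, ?_⟩
        congr 1; omega
      · intro y y' h
        exact (Fin.cons_injective2 h).2
    · rw [pivots, if_neg hp]
      have hS : solutions M =
          (fun p : Bool × (Fin (m + 1) → Bool) => (Fin.cons p.1 p.2 : Fin (m + 2) → Bool)) ''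
            (Set.univ ×ˢ solutions (eliminateFirst M)) := by
        ext x
        constructor
        · intro hx
          exact ⟨(x 0, Fin.tail x), ⟨Set.mem_univ _, tail_mem_solutions hx⟩, Fin.cons_self_tail x⟩
        · rintro ⟨⟨b, y⟩, ⟨-, hy⟩, rfl⟩
          exact hsucc b y hy fun j hj => absurd ⟨j, hj⟩ hp
      rw [hS, Set.ncard_image_of_injective, Set.ncard_prod, h2, Set.ncard_univ]
      · refine ⟨by omega, ?_⟩
        rw [Nat.card_eq_fintype_card, Fintype.card_bool, ← pow_succ']
        congr 1; omega
      · rintro ⟨b, y⟩ ⟨b', y'⟩ h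
        have := Fin.cons_injective2 h
        exact Prod.ext this.1 this.2

/-- The entries of a matrix, row by row. -/
def entries {m n : ℕ} (M : Fin m → Fin n → Bool) : List Bool :=
  (List.ofFn fun i => List.ofFn (M i)).flatten

lemma zipWith_ofFn {n : ℕ} (f : Bool → Bool → Bool) (a b : Fin n → Bool) :
    List.zipWith f (List.ofFn a) (List.ofFn b) = List.ofFn fun j => f (a j) (b j) := by
  apply List.ext_getElem
  · simp
  · intro k h1 h2; simp

lemma run_eliminate {o : List Bool} (m : ℕ) (M : Fin m → Fin (m + 1) → Bool) (l : List Bool)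
    (hl : l.length = m + 1) (u : ℕ) : ∃ t ≤ 20 * m ^ 3, ∃ l', l'.length = 1 ∧
      Run t (at_ eliminate (entries M) l [] [] (List.replicate u true) o)
        (at_ eliminate [] l' [] [] (List.replicate (u - pivots m M) true) o) := by
  induction m generalizing l u with
  | zero => exact ⟨0, by simp, l, hl, Run.refl _⟩
  | succ m ih =>
    obtain ⟨a, l, rfl⟩ := List.exists_cons_of_length_pos (l := l) (by omega)
    have h1 := run_eliminate_row (u := List.replicate u true) (o := o) a (M 0 0)
      (List.ofFn fun j => M 0 (Fin.succ j)) (l := l) (by simpa using hl)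
      (List.ofFn fun i : Fin m => (M i.succ 0, List.ofFn fun j => M i.succ (Fin.succ j)))
      (by intro v hv; rw [List.mem_ofFn'] at hv; obtain ⟨i, rfl⟩ := hv; simp)
    have hI : (M 0 0 :: List.ofFn fun j => M 0 (Fin.succ j)) ++
        ((List.ofFn fun i : Fin m =>
          (M i.succ 0, List.ofFn fun j => M i.succ (Fin.succ j))).map
            fun v => v.1 :: v.2).flatten = entries M := by
      rw [entries, List.ofFn_succ (f := fun i => List.ofFn (M i)), List.flatten_cons,
        List.ofFn_succ (f := M 0), List.map_ofFn]
      congr 3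
      funext i
      exact (List.ofFn_succ (f := M i.succ)).symm
    have hI' : ((List.ofFn fun i : Fin m =>
        (M i.succ 0, List.ofFn fun j => M i.succ (Fin.succ j))).map fun v =>
          List.zipWith (fun p q => p || (v.1 && q)) v.2
            (List.ofFn fun j => M 0 (Fin.succ j))).flatten = entries (eliminateFirst M) := by
      rw [entries, List.map_ofFn]
      congr 2
      funext i
      simp only [Function.comp, zipWith_ofFn]
      rfl
    have hU : (bif (List.ofFn fun j => M 0 (Fin.succ j)).any id then (List.replicate u true).tail
        else List.replicate u true) =
          List.replicate (u - if ∃ j : Fin (m + 1), M 0 j.succ = true then 1 else 0) true := by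
      have : (List.ofFn fun j => M 0 (Fin.succ j)).any id = true ↔
          ∃ j : Fin (m + 1), M 0 j.succ = true := by
        simp only [List.any_eq_true, List.mem_ofFn', Set.exists_range_iff, id]
      by_cases h : ∃ j : Fin (m + 1), M 0 j.succ = true
      · rw [if_pos h, this.2 h]; simp
      · rw [if_neg h, Bool.eq_false_iff.2 (mt this.1 h)]; simp
    rw [hI, hI', hU] at h1
    obtain ⟨t, ht, l', hl', h2⟩ := ih (eliminateFirst M) (List.ofFn fun j => M 0 (Fin.succ j))
      (by simp) (u - if ∃ j : Fin (m + 1), M 0 j.succ = true then 1 else 0)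
    refine ⟨_, ?_, l', hl', (h1.trans h2).of_eq rfl ?_⟩
    · simp only [List.length_ofFn]
      nlinarith
    -- Popping an empty counter matches truncated subtraction, so no comparison of `u` with the
    -- pivots is needed.
    · rw [Nat.sub_sub, pivots]

/-! ### The matrix of a graph -/

open Classical in
/-- The adjacency matrix with an additional column that marks the vertices of odd degree. -/
noncomputable def markedMatrix {n : ℕ} (G : SimpleGraph (Fin n)) (i : Fin n) :
    Fin (n + 1) → Bool :=
  Fin.snoc (α := fun _ => Bool) (fun j => decide (G.Adj i j)) (decide (Odd (deg G i)))

/-- The additional vertex has label 0 and is joined to all odd vertices, which forces them to 0. -/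
lemma ncard_solutions_markedMatrix {n : ℕ} (G : SimpleGraph (Fin n)) :
    (solutions (markedMatrix G)).ncard = (evenLabelings G).ncard := by
  classical
  have : solutions (markedMatrix G) =
      (fun x => Fin.snoc (α := fun _ => Bool) x false) '' evenLabelings G := by
    ext x
    constructor
    · rintro ⟨h1, h2⟩
      refine ⟨Fin.init x, ⟨fun u v huv => ?_, fun v hv => ?_⟩, ?_⟩
      · exact h2 u v.castSucc (by simp [markedMatrix, huv])
      · exact (h2 v (Fin.last n) (by simp [markedMatrix, hv])).trans h1
      · rw [← h1]; exact Fin.snoc_init_self x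
    · rintro ⟨y, hy, rfl⟩
      refine ⟨by simp, fun i j h => ?_⟩
      cases j using Fin.lastCases with
      | cast j => simpa using hy.1 i j (by simpa [markedMatrix] using h)
      | last => simpa using hy.2 i (by simpa [markedMatrix] using h)
  rw [this, Set.ncard_image_of_injective]
  intro x y h
  exact (Fin.snoc_injective2 (α := fun _ => Bool) h).1

/-- The dimension is `n` minus the pivots, so the number of vertices cancels. -/
lemma splitRank_sub_card {n : ℕ} (G : SimpleGraph (Fin n)) :
    splitRank G - Nat.card (Fin n) =
      ∑ v, (deg G v + 1) / 2 - pivots n (markedMatrix G) := by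
  classical
  obtain ⟨h1, h2⟩ := ncard_solutions (markedMatrix G) fun i j => by
    simp [markedMatrix, G.adj_comm]
  rw [splitRank, finsum_eq_sum_of_fintype, ← ncard_solutions_markedMatrix, h2,
    Nat.log_pow (by norm_num), Nat.card_eq_fintype_card, Fintype.card_fin]
  omega

lemma count_true_ofFn {n : ℕ} (f : Fin n → Bool) :
    (List.ofFn f).count true = ∑ j, if f j = true then 1 else 0 := by
  induction n with
  | zero => simp
  | succ n ih =>
    rw [List.ofFn_succ, List.count_cons, ih, Fin.sum_univ_succ, add_comm]
    simp

open Classical in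
lemma count_true_row {n : ℕ} (G : SimpleGraph (Fin n)) (i : Fin n) :
    (List.ofFn fun j => decide (G.Adj i j)).count true = deg G i := by
  rw [count_true_ofFn, deg_eq_sum]
  simp only [decide_eq_true_eq]

open Classical in
lemma encodeGraph_eq {n : ℕ} (G : SimpleGraph (Fin n)) : encodeGraph G =
    List.replicate n true ++ false ::
      (List.ofFn fun i => List.ofFn fun j => decide (G.Adj i j)).flatten := by
  simp only [encodeGraph, List.ofFn_eq_map, List.flatMap_def]

lemma length_encodeGraph {n : ℕ} (G : SimpleGraph (Fin n)) :
    (encodeGraph G).length = n + 1 + n ^ 2 := by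
  classical
  rw [encodeGraph_eq]
  simp [List.length_flatten, List.map_ofFn, Function.comp_def]
  ring

lemma sum_half_deg_le {n : ℕ} (G : SimpleGraph (Fin n)) : ∑ v, (deg G v + 1) / 2 ≤ n ^ 2 := by
  have : ∀ v ∈ (Finset.univ : Finset (Fin n)), (deg G v + 1) / 2 ≤ n := by
    intro v _
    have h1 : deg G v ≤ n := by
      have := Set.ncard_le_card (G.neighborSet v)
      simpa [deg] using this
    have h2 := v.pos
    omega
  have := Finset.sum_le_sum this
  simpa [sq] using this

lemma run_machine {n : ℕ} (G : SimpleGraph (Fin n)) :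
    ∃ t ≤ 100 * (encodeGraph G).length ^ 3,
      Run t (at_ readSize (encodeGraph G) [] [] [] [] [])
        ⟨none, (none, none),
          store [] [] [] [] [] (Computability.encodeNat (splitRank G - Nat.card (Fin n)))⟩ := by
  classical
  have h1 := run_readSize (i := (List.ofFn fun i => List.ofFn fun j => decide (G.Adj i j)).flatten)
    (r := []) (y := []) (u := []) (o := []) n 0
  rw [← encodeGraph_eq, zero_add] at h1
  have h2 := run_degNext (y := []) (o := []) n
    (List.ofFn fun i => List.ofFn fun j => decide (G.Adj i j))
    (by intro w hw; rw [List.mem_ofFn'] at hw; obtain ⟨i, rfl⟩ := hw; simp)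
    (by rintro h rfl; simp at h) 0
  have h3 := (h1.trans h2).trans run_back
  have hsum : ((List.ofFn fun i => List.ofFn fun j => decide (G.Adj i j)).map
      fun w => (w.count true + 1) / 2).sum = ∑ v, (deg G v + 1) / 2 := by
    rw [List.map_ofFn, List.sum_ofFn]
    simp only [Function.comp, count_true_row]
  have hent : ((List.ofFn fun i => List.ofFn fun j => decide (G.Adj i j)).map
      fun w => w ++ [decide (Odd (w.count true))]).flatten = entries (markedMatrix G) := by
    rw [entries, List.map_ofFn]
    congr 2
    funext i
    simp only [Function.comp, count_true_row]
    rw [List.ofFn_succ', List.concat_eq_append]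
    simp [markedMatrix]
  have hlen : (entries (markedMatrix G)).length = n * (n + 1) := by
    simp [entries, List.length_flatten, List.map_ofFn, Function.comp_def]
  rw [hsum, hent, zero_add, List.append_nil, List.append_nil, List.reverse_reverse] at h3
  obtain ⟨t, ht, l', hl', h4⟩ := run_eliminate (o := []) n (markedMatrix G)
    (List.replicate (n + 1) true) (by simp) (∑ v, (deg G v + 1) / 2)
  rw [← splitRank_sub_card] at h4
  obtain ⟨a, rfl⟩ := List.length_eq_one_iff.1 hl'
  obtain ⟨t', ht', h5⟩ := run_toBinary (i := []) (l := []) (y := []) 0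
    (splitRank G - Nat.card (Fin n))
  -- The last call of `eliminate` also removes the one symbol left on `L`, so that only the output
  -- remains at the end.
  have h6 : Turing.TM2.step program (at_ eliminate [] [a] [] []
      (List.replicate (splitRank G - Nat.card (Fin n)) true) []) =
      some (at_ toBinary [] [] [] []
        (List.replicate (splitRank G - Nat.card (Fin n)) true) (Computability.encodeNat 0)) := by
    simp [at_, Turing.TM2.step, program, Code.popFst, Code.ifEmpty, Code.go,
      Turing.TM2.stepAux, Computability.encodeNat, Computability.encodeNum]
  refine ⟨_, ?_, ((h3.trans h4).trans (Run.head h6 h5)).of_eq rfl (by rw [zero_add])⟩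
  have hle : splitRank G - Nat.card (Fin n) ≤ n ^ 2 := by
    rw [splitRank_sub_card]
    exact (Nat.sub_le _ _).trans (sum_half_deg_le G)
  rw [length_encodeGraph, List.length_reverse, hlen, List.length_ofFn]
  have h7 : t' ≤ n ^ 2 * (2 * n ^ 2 + 3) + 1 := by
    refine ht'.trans ?_
    gcongr
    omega
  -- Both `n` and `n ^ 2` are at most the input length `N`, so every phase is at most cubic in `N`.
  generalize hN : n + 1 + n ^ 2 = N
  have hn : n ≤ N := by omega
  have hn2 : n ^ 2 ≤ N := by omega
  have hN1 : 1 ≤ N := by omega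
  have e1 : n ^ 3 ≤ N ^ 3 := Nat.pow_le_pow_left hn 3
  have e2 : N ≤ N ^ 3 := Nat.le_self_pow (by norm_num) N
  have e3 : N ^ 2 ≤ N ^ 3 := Nat.pow_le_pow_right hN1 (by norm_num)
  have e4 : n ^ 2 * (2 * n ^ 2 + 3) ≤ N * (2 * N + 3) := by gcongr
  nlinarith

lemma initList_machine (w : List Bool) :
    Turing.initList machine (w.map (Equiv.refl Bool).invFun) = at_ readSize w [] [] [] [] [] := by
  refine (congrArg (Turing.initList machine) (List.map_id w)).trans ?_
  unfold Turing.initList at_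
  congr 1
  funext k
  cases k <;> rfl

lemma haltList_machine (w : List Bool) :
    Turing.haltList machine (w.map (Equiv.refl Bool).invFun) =
      ⟨none, (none, none), store [] [] [] [] [] w⟩ := by
  refine (congrArg (Turing.haltList machine) (List.map_id w)).trans ?_
  unfold Turing.haltList
  congr 1
  funext k
  cases k <;> rfl

theorem polyTimeOnTriangleFreeGraphs {f : TriangleFreeGraph → ℕ}
    (hf : ∀ G, f G = splitRank G.2.1 - Nat.card (Fin G.1)) : PolyTimeOnTriangleFreeGraphs f := by
  refine ⟨{ tm := machine, inputAlphabet := Equiv.refl Bool, outputAlphabet := Equiv.refl Bool,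
            time := Polynomial.C 100 * Polynomial.X ^ 3, outputsFun := fun G => ?_ }⟩
  have h := run_machine G.2.1
  rw [← hf] at h
  refine ⟨⟨h.choose, ?_⟩, by simpa using h.choose_spec.1⟩
  exact (congrArg (fun c => (flip bind machine.step)^[h.choose] (some c))
    (initList_machine _)).trans
      (Eq.trans (show _ = _ from h.choose_spec.2) (congrArg some (haltList_machine _).symm))

end VertexSplitting

theorem mainTheorem5 :
    (∀ (V : Type) [Finite V] (G : SimpleGraph V), G.CliqueFree 3 →
      IsLeast (VertexSplitting.unitIntervalSplitLengths G) (VertexSplitting.UIVS G) ∧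
      IsLeast (VertexSplitting.unitIntervalExclusiveSplitLengths G) (VertexSplitting.UIVXS G)) ∧
    VertexSplitting.PolyTimeOnTriangleFreeGraphs (fun G => VertexSplitting.UIVS G.2.1) ∧
    VertexSplitting.PolyTimeOnTriangleFreeGraphs (fun G => VertexSplitting.UIVXS G.2.1) := by
  refine ⟨fun V _ G hG => ?_, ?_, ?_⟩
  · rw [VertexSplitting.UIVS_eq hG, VertexSplitting.UIVXS_eq hG]
    exact VertexSplitting.isLeast_unitIntervalSplitLengths hG
  · exact VertexSplitting.polyTimeOnTriangleFreeGraphs fun G => VertexSplitting.UIVS_eq G.2.2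
  · exact VertexSplitting.polyTimeOnTriangleFreeGraphs fun G => VertexSplitting.UIVXS_eq G.2.2
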